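/- **Setting.** Let $\Theta\subseteq\mathbb R^{p}$ be closed without isolated points and $\Upsilon\subseteq\mathbb R^{d}$ measurable. Let $\theta\in\Theta$ have prior density $p(\theta)$, and let an observation $x\in\Upsilon$ have conditional density $p(x|\theta)$; write $p(x,\theta)=p(\theta)p(x|\theta)$. Fix $m\ge 1$ and let $\mathcal X=(x_1,\dots,x_m)$ be i.i.d. given $\theta$, so $p(\mathcal X,\theta)=p(\theta)\prod_j p(x_j|\theta)$, with posterior density $p(\theta|\mathcal X)$. The Bayesian Fisher information matrix and the Bayesian Cramér–Rao bound (BCRB) are $$F_B=\mathbb E\big[\nabla_\theta\log p(\mathcal X,\theta)\,\nabla_\theta\log p(\mathcal X,\theta)^T\big],\qquad \mathrm{BCRB}=F_B^{-1}.$$ Say that a function $f$ of $\theta$ *vanishes at the boundary* if $f(\theta)\to0$ as $\theta\in\Theta$, $\theta\neq\theta_0$, tends to any $\theta_0\in\partial\Theta$ and, if $\Theta$ is unbounded, as $\theta\in\Theta$ tends to infinity. **Model and data.** Let $s(\theta|\mathcal X;\Omega)\in\mathbb R^p$ be a parametrized score model (neural network), measurable in $(\theta,\mathcal X)$, with parameters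 $\Omega$ in a compact set $S\subset\mathbb R^k$. Let $(\theta_n,\mathcal X_n)_{n\ge1}$ be i.i.d. with density $p(\mathcal X,\theta)$. For each $N\ge1$ let $\Omega^*_N$ be, almost surely, a global minimizer over $S$ of the empirical score matching loss $$\frac1N\sum_{n=1}^N\Big(\|s(\theta_n|\mathcal X_n;\Omega)\|_2^2+2\,\mathrm{tr}\,\tfrac{\partial s(\theta_n|\mathcal X_n;\Omega)}{\partial\theta}\Big),$$ and let the learned Fisher information matrix and the learned BCRB be $$\hat F_{B,N}=\frac1N\sum_{n=1}^N s(\theta_n|\mathcal X_n;\Omega^*_N)\,s(\theta_n|\mathcal X_n;\Omega^*_N)^T\quad\text{and}\quad \hat F_{B,N}^{-1}.$$ **Assumptions.** 1. (BCRB regularity.) For $\theta$ in the interior of $\Theta$, $\nabla_\theta\log p(x,\theta)$ exists wherever $p(x,\theta)>0$ and $\nabla_\theta\log p(\theta)$ exists wherever $p(\theta)>0$. The vector $\nabla_\theta\log p(x,\theta)$ is integrable under the law of $(x,\theta)$, and $\mathbb E[\nabla_\theta\log p(x,\theta)\nabla_\theta\log p(x,\theta)^T]$ is finite and positive definite. For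 every $x\in\Upsilon$, $\theta\,p(x,\theta)$ vanishes at the boundary. For almost every $x$, $\mathbb E[\nabla_\theta\log p(x,\theta)\,|\,x]=0$. The support $\{x\in\Upsilon:p(x,\theta)>0\}$ is the same for all $\theta$ in the interior of $\Theta$. 2. (Score matching regularity.) For $\theta$ in the interior of $\Theta$ and $\mathcal X\in\Upsilon^m$, $\log p(\theta|\mathcal X)$ is differentiable in $\theta$ wherever $p(\mathcal X,\theta)>0$, and so is $s(\theta|\mathcal X;\Omega)$ for every $\Omega\in S$. The expectations $\mathbb E\|\nabla_\theta\log p(\theta|\mathcal X)\|_2^2$ and $\mathbb E\|s(\theta|\mathcal X;\Omega)\|_2^2$, $\Omega\in S$, are finite. For all $\mathcal X\in\Upsilon^m$ and $\Omega\in S$, $s(\theta|\mathcal X;\Omega)\,p(\theta|\mathcal X)$ vanishes at the boundary. 3. (Lipschitz continuity.) There are functions $\xi,\tau,\zeta$ of $z=(\theta,\mathcal X)$ with $\mathbb E[\xi(z)^2],\mathbb E[\tau(z)],\mathbb E[\zeta(z)]<\infty$ such that, for almost every $z$ and all $\Omega_1,\Omega_2\in S$, writing $s_i=s(\theta|\mathcal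 X;\Omega_i)$, $$\|s_1-s_2\|_2\le\xi(z)\|\Omega_1-\Omega_2\|_2,\quad \Big\|\tfrac{\partial s_1}{\partial\theta}-\tfrac{\partial s_2}{\partial\theta}\Big\|_2\le\tau(z)\|\Omega_1-\Omega_2\|_2,\quad \|s_1s_1^T-s_2s_2^T\|_F\le\zeta(z)\|\Omega_1-\Omega_2\|_2 .$$ 4. (Realizability.) There is $\Omega_0\in S$ with $s(\theta|\mathcal X;\Omega_0)=\nabla_\theta\log p(\theta|\mathcal X)$ for almost every $(\theta,\mathcal X)$. 5. (Score bound.) There are $c_B=c_B(N)$, which may depend on the data, such that almost surely $\|s(\theta_n|\mathcal X_n;\Omega^*_N)\|_2^2\le c_B(N)$ for all $N\ge1$ and $1\le n\le N$, and $c_B(N)/N\to0$ almost surely as $N\to\infty$. **Conclusion.** $F_B$ is positive definite; almost surely, $\hat F_{B,N}$ is positive definite for all sufficiently large $N$, and $$\lim_{N\to\infty}\hat F_{B,N}^{-1}=F_B^{-1}=\mathrm{BCRB}\qquad\text{almost surely.}$$ -/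

import Mathlib

open MeasureTheory ProbabilityTheory Filter Topology

noncomputable section

namespace LBCRB

/-- `ℝⁿ` with the Euclidean norm. -/
abbrev Vec (n : ℕ) := EuclideanSpace ℝ (Fin n)

/-- A Bayesian model: a parameter `θ ∈ Θ ⊆ ℝᵖ` with prior density `prior`, and a single
observation `x ∈ Υ ⊆ ℝᵈ` with conditional density `lik θ x` (densities with respect to Lebesgue
measure on `Θ` and `Υ`).  The parameter set is closed and has no isolated points. -/
structure BayesModel (p d : ℕ) where
  Θ : Set (Vec p)
  Υ : Set (Vec d)
  prior : Vec p → ℝ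
  lik : Vec p → Vec d → ℝ
  perfect_Θ : Perfect Θ
  measurableSet_Υ : MeasurableSet Υ
  measurable_prior : Measurable prior
  measurable_lik : Measurable (Function.uncurry lik)
  prior_nonneg : ∀ θ ∈ Θ, 0 ≤ prior θ
  lik_nonneg : ∀ θ ∈ Θ, ∀ x ∈ Υ, 0 ≤ lik θ x
  integral_prior : ∫ θ in Θ, prior θ = 1
  integral_lik : ∀ θ ∈ Θ, ∫ x in Υ, lik θ x = 1

section Joint

variable {p : ℕ} {X : Type*} [MeasurableSpace X]

/-- The law on `ℝᵖ × X` that has density `q` with respect to (Lebesgue measure on `Θ`) `× ν`. -/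
def jointLaw (Θ : Set (Vec p)) (ν : Measure X) (q : Vec p → X → ℝ) : Measure (Vec p × X) :=
  ((volume.restrict Θ).prod ν).withDensity (fun z => ENNReal.ofReal (q z.1 z.2))

/-- The posterior density of `θ` given `x`, for the joint density `q`. -/
def posterior (Θ : Set (Vec p)) (q : Vec p → X → ℝ) (θ : Vec p) (x : X) : ℝ :=
  q θ x / ∫ t in Θ, q t x

/-- The score `∇_θ log q(θ, x)`; `q` may be a joint density or a posterior density. -/
def score (q : Vec p → X → ℝ) (θ : Vec p) (x : X) : Vec p :=
  gradient (fun t => Real.log (q t x)) θ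

/-- The Bayesian Fisher information matrix `E[∇_θ log q(θ, x) ∇_θ log q(θ, x)ᵀ]`, where `(θ, x)`
has joint density `q`. -/
def bfim (Θ : Set (Vec p)) (ν : Measure X) (q : Vec p → X → ℝ) : Matrix (Fin p) (Fin p) ℝ :=
  Matrix.of fun i j => ∫ z, score q z.1 z.2 i * score q z.1 z.2 j ∂(jointLaw Θ ν q)

end Joint

/-- `f(θ) → 0` as `θ ∈ Θ` tends to any boundary point of `Θ`, and, if `Θ` is unbounded, as
`θ ∈ Θ` tends to infinity. -/
def VanishesAtBoundary {p : ℕ} (Θ : Set (Vec p)) (f : Vec p → Vec p) : Prop :=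
  (∀ θ₀ ∈ frontier Θ, Tendsto f (𝓝[Θ \ {θ₀}] θ₀) (𝓝 0)) ∧
    Tendsto f (cocompact (Vec p) ⊓ 𝓟 Θ) (𝓝 0)

namespace BayesModel

variable {p d : ℕ} (M : BayesModel p d)

/-- The joint density of the parameter and one observation. -/
def joint (θ : Vec p) (x : Vec d) : ℝ := M.prior θ * M.lik θ x

/-- The joint density of the parameter and `m` observations that are i.i.d. given it. -/
def jointSet (m : ℕ) (θ : Vec p) (x : Fin m → Vec d) : ℝ := M.prior θ * ∏ j, M.lik θ (x j)

/-- The reference measure of one observation. -/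
def obsMeasure : Measure (Vec d) := volume.restrict M.Υ

/-- The reference measure of `m` observations. -/
def obsSetMeasure (m : ℕ) : Measure (Fin m → Vec d) := Measure.pi fun _ => M.obsMeasure

/-- The law of the parameter and one observation. -/
def law : Measure (Vec p × Vec d) := jointLaw M.Θ M.obsMeasure M.joint

/-- The law of the parameter and `m` observations that are i.i.d. given it. -/
def lawSet (m : ℕ) : Measure (Vec p × (Fin m → Vec d)) :=
  jointLaw M.Θ (M.obsSetMeasure m) (M.jointSet m)

/-- The Bayesian Fisher information matrix of a measurement that consists of `m` observations. -/
def F_B (m : ℕ) : Matrix (Fin p) (Fin p) ℝ := bfim M.Θ (M.obsSetMeasure m) (M.jointSet m)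

/-- The Bayesian Cramér–Rao bound for a measurement that consists of `m` observations. -/
def bcrb (m : ℕ) : Matrix (Fin p) (Fin p) ℝ := (M.F_B m)⁻¹

/-- The true posterior score `∇_θ log p(θ | x₁, …, x_m)`. -/
def postScore (m : ℕ) (θ : Vec p) (x : Fin m → Vec d) : Vec p :=
  score (posterior M.Θ (M.jointSet m)) θ x

/-- The regularity conditions of the Bayesian Cramér–Rao bound, for the joint density of the
parameter and one observation. -/
structure BCRBRegular : Prop where
  diff_joint : ∀ x ∈ M.Υ, ∀ θ ∈ interior M.Θ, 0 < M.joint θ x →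
    DifferentiableAt ℝ (fun t => Real.log (M.joint t x)) θ
  integrable_score : Integrable (fun z => score M.joint z.1 z.2) M.law
  diff_prior : ∀ θ ∈ interior M.Θ, 0 < M.prior θ →
    DifferentiableAt ℝ (fun t => Real.log (M.prior t)) θ
  fim_finite : MemLp (fun z => score M.joint z.1 z.2) 2 M.law
  fim_posDef : (bfim M.Θ M.obsMeasure M.joint).PosDef
  boundary : ∀ x ∈ M.Υ, VanishesAtBoundary M.Θ (fun θ => M.joint θ x • θ)
  condExp_score : ∀ᵐ x ∂M.obsMeasure,
    ∫ θ in M.Θ, posterior M.Θ M.joint θ x • score M.joint θ x = 0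
  common_support : ∃ A ⊆ M.Υ, ∀ θ ∈ interior M.Θ, {x ∈ M.Υ | 0 < M.joint θ x} = A

end BayesModel

section Network

variable {p d k m : ℕ}

/-- The Jacobian `∂s(θ | x; w)/∂θ` of a parametrized score model. -/
def jac (s : Vec p → (Fin m → Vec d) → Vec k → Vec p)
    (θ : Vec p) (x : Fin m → Vec d) (w : Vec k) : Vec p →L[ℝ] Vec p :=
  fderiv ℝ (fun t => s t x w) θ

/-- The outer product `v vᵀ`. -/
def outer (v : Vec p) : Matrix (Fin p) (Fin p) ℝ := Matrix.of fun i j => v i * v j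

/-- The Frobenius norm. -/
def frobNorm (A : Matrix (Fin p) (Fin p) ℝ) : ℝ := √(∑ i, ∑ j, A i j ^ 2)

/-- Score matching regularity of the posterior and of the model `s`, whose parameters range over
`S`, together with the boundary condition of score matching. -/
structure ScoreMatchingRegular (M : BayesModel p d) (S : Set (Vec k))
    (s : Vec p → (Fin m → Vec d) → Vec k → Vec p) : Prop where
  diff_post : ∀ x : Fin m → Vec d, (∀ j, x j ∈ M.Υ) → ∀ θ ∈ interior M.Θ,
    0 < M.jointSet m θ x →
    DifferentiableAt ℝ (fun t => Real.log (posterior M.Θ (M.jointSet m) t x)) θ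
  memLp_post : MemLp (fun z => M.postScore m z.1 z.2) 2 (M.lawSet m)
  measurable_model : ∀ w ∈ S, Measurable (fun z : Vec p × (Fin m → Vec d) => s z.1 z.2 w)
  diff_model : ∀ w ∈ S, ∀ x : Fin m → Vec d, (∀ j, x j ∈ M.Υ) → ∀ θ ∈ interior M.Θ,
    DifferentiableAt ℝ (fun t => s t x w) θ
  memLp_model : ∀ w ∈ S, MemLp (fun z => s z.1 z.2 w) 2 (M.lawSet m)
  boundary : ∀ w ∈ S, ∀ x : Fin m → Vec d, (∀ j, x j ∈ M.Υ) →
    VanishesAtBoundary M.Θ (fun θ => posterior M.Θ (M.jointSet m) θ x • s θ x w)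

/-- The true posterior score is one of the functions that the model can represent. -/
def Realizable (M : BayesModel p d) (S : Set (Vec k))
    (s : Vec p → (Fin m → Vec d) → Vec k → Vec p) : Prop :=
  ∃ w ∈ S, ∀ᵐ z ∂(M.lawSet m), s z.1 z.2 w = M.postScore m z.1 z.2

/-- Lipschitz continuity in the model parameters of the score model, of its Jacobian (in spectral
norm) and of its outer product (in Frobenius norm), with Lipschitz constants `ξ`, `τ`, `ζ` that
depend on the sample and satisfy `E[ξ²], E[τ], E[ζ] < ∞`. -/
def LipschitzModel (M : BayesModel p d) (S : Set (Vec k))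
    (s : Vec p → (Fin m → Vec d) → Vec k → Vec p) : Prop :=
  ∃ ξ τ ζ : Vec p × (Fin m → Vec d) → ℝ,
    MemLp ξ 2 (M.lawSet m) ∧ Integrable τ (M.lawSet m) ∧ Integrable ζ (M.lawSet m) ∧
    ∀ᵐ z ∂(M.lawSet m), ∀ w₁ ∈ S, ∀ w₂ ∈ S,
      ‖s z.1 z.2 w₁ - s z.1 z.2 w₂‖ ≤ ξ z * ‖w₁ - w₂‖ ∧
      ‖jac s z.1 z.2 w₁ - jac s z.1 z.2 w₂‖ ≤ τ z * ‖w₁ - w₂‖ ∧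
      frobNorm (outer (s z.1 z.2 w₁) - outer (s z.1 z.2 w₂)) ≤ ζ z * ‖w₁ - w₂‖

/-- The per-sample score matching loss `‖s(θ | x; w)‖² + 2 tr(∂s(θ | x; w)/∂θ)`. -/
def sampleLoss (s : Vec p → (Fin m → Vec d) → Vec k → Vec p)
    (z : Vec p × (Fin m → Vec d)) (w : Vec k) : ℝ :=
  ‖s z.1 z.2 w‖ ^ 2 + 2 * ∑ i, jac s z.1 z.2 w (EuclideanSpace.single i 1) i

/-- The empirical score matching loss over the data set `z₀, …, z_{N-1}`. -/
def empLoss (s : Vec p → (Fin m → Vec d) → Vec k → Vec p)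
    (z : ℕ → Vec p × (Fin m → Vec d)) (N : ℕ) (w : Vec k) : ℝ :=
  (1 / (N : ℝ)) * ∑ n ∈ Finset.range N, sampleLoss s (z n) w

/-- The learned Bayesian Fisher information matrix over the data set `z₀, …, z_{N-1}`, for the
model parameter `w`. -/
def learnedBFIM (s : Vec p → (Fin m → Vec d) → Vec k → Vec p)
    (z : ℕ → Vec p × (Fin m → Vec d)) (N : ℕ) (w : Vec k) : Matrix (Fin p) (Fin p) ℝ :=
  (1 / (N : ℝ)) • ∑ n ∈ Finset.range N, outer (s (z n).1 (z n).2 w)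

/-- The learned Bayesian Cramér–Rao bound. -/
def learnedBCRB (s : Vec p → (Fin m → Vec d) → Vec k → Vec p)
    (z : ℕ → Vec p × (Fin m → Vec d)) (N : ℕ) (w : Vec k) : Matrix (Fin p) (Fin p) ℝ :=
  (learnedBFIM s z N w)⁻¹

end Network

end LBCRB

end

open LBCRB

/-! Consistency. Let `w₀` realize the posterior score. Integration by parts in `θ`
(`setIntegral_stein`, `integral_stein`) turns the expected excess loss of `w` over `w₀` into the
mean squared error `E‖s_w - s_{w₀}‖²`. The excess loss obeys a uniform law of large numbers over the
compact set `S` (`ae_tendsto_empMean_sub_integral`), and the empirical excess of a minimizer is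
nonpositive, so its mean squared error tends to zero. The minimizers themselves need not converge.
The uniform law for the products `s_i s_j`, combined with this L² convergence, yields the limit
`F_B` of the learned matrices, and inversion is continuous at an invertible matrix.

Positive definiteness. If `F_B` degenerates along `a`, the joint density of the `m` observations has
zero logarithmic derivative along `a` almost everywhere, hence is locally constant along `a`.
Integrating out all but one observation preserves this, so the one-observation information matrix
degenerates along `a` too, contrary to assumption.

Analytic difficulty. `Θ` is merely closed, and differentiability holds only in its interior. The
frontier may have positive measure, but the boundary condition makes the prior vanish almost
everywhere on it. Integration by parts cuts off the small values of the function, which leaves a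
differentiable function of compact support (`integral_fderiv_eq_zero_of_vanishes`). -/

namespace LBCRB

/-! ### Integration by parts and local constancy for merely differentiable functions -/

section Analysis

variable {E : Type*} [NormedAddCommGroup E] [NormedSpace ℝ E]

/-- A continuous weight that vanishes on `[-1, 1]` and equals `1` outside `[-2, 2]`. -/
noncomputable def truncWeight (u : ℝ) : ℝ := max 0 (min 1 (|u| - 1))

lemma continuous_truncWeight : Continuous truncWeight := by
  unfold truncWeight; fun_prop

lemma truncWeight_nonneg (u : ℝ) : 0 ≤ truncWeight u := le_max_left _ _

lemma truncWeight_le_one (u : ℝ) : truncWeight u ≤ 1 :=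
  max_le zero_le_one (min_le_left _ _)

lemma truncWeight_eq_zero {u : ℝ} (hu : |u| ≤ 1) : truncWeight u = 0 :=
  max_eq_left ((min_le_right _ _).trans (by linarith))

lemma truncWeight_eq_one {u : ℝ} (hu : 2 ≤ |u|) : truncWeight u = 1 := by
  rw [truncWeight, min_eq_left (by linarith), max_eq_right zero_le_one]

/-- A `C¹` truncation of the identity that vanishes where `|c t| ≤ 1`. -/
noncomputable def softTrunc (c t : ℝ) : ℝ := ∫ u in (0 : ℝ)..t, truncWeight (c * u)

lemma hasDerivAt_softTrunc (c t : ℝ) : HasDerivAt (softTrunc c) (truncWeight (c * t)) t := by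
  have hc : Continuous fun u => truncWeight (c * u) := continuous_truncWeight.comp (by fun_prop)
  exact intervalIntegral.integral_hasDerivAt_right (hc.intervalIntegrable _ _)
    (hc.stronglyMeasurableAtFilter _ _) hc.continuousAt

lemma softTrunc_eq_zero {c t : ℝ} (h : |c * t| ≤ 1) : softTrunc c t = 0 := by
  refine intervalIntegral.integral_zero_ae (ae_of_all _ fun u hu => truncWeight_eq_zero ?_)
  refine le_trans ?_ h
  rw [abs_mul, abs_mul]
  refine mul_le_mul_of_nonneg_left ?_ (abs_nonneg _)
  simpa using Set.abs_sub_left_of_mem_uIcc (Set.uIoc_subset_uIcc hu)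

variable [FiniteDimensional ℝ E] [MeasurableSpace E] [BorelSpace E]
  {μ : Measure E} [μ.IsAddHaarMeasure]

/-- The derivative of a function vanishes almost everywhere on its zero set. -/
lemma ae_fderiv_eq_zero_of_eq_zero {U : Set E} (hU : IsOpen U) {f : E → ℝ}
    (hf : ∀ x ∈ U, DifferentiableAt ℝ f x) (v : E) :
    ∀ᵐ x ∂μ.restrict U, f x = 0 → fderiv ℝ f x v = 0 := by
  have hcont : ContinuousOn f U := fun x hx => (hf x hx).continuousAt.continuousWithinAt
  have hmeas : MeasurableSet (U ∩ f ⁻¹' {0}) := by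
    have h1 : U ∩ f ⁻¹' {0} = U \ (U ∩ f ⁻¹' {0}ᶜ) := by ext; simp
    rw [h1]
    exact hU.measurableSet.diff
      (hcont.isOpen_inter_preimage hU isOpen_compl_singleton).measurableSet
  -- Multiplying by `v` gives a self-map of `E`. It is constant on the zero set, so the
  -- density-point estimate for approximately linear maps applies with constant 0.
  have happ : ApproximatesLinearOn (fun x => f x • v) (0 : E →L[ℝ] E) (U ∩ f ⁻¹' {0}) 0 := by
    intro x hx y hy
    simp [show f x = 0 from hx.2, show f y = 0 from hy.2]
  have key := happ.norm_fderiv_sub_le μ hmeas (fun x => (fderiv ℝ f x).smulRight v)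
    (fun x hx => ((hf x hx.1).hasFDerivAt.smul_const v).hasFDerivWithinAt)
  rw [ae_restrict_iff' hmeas] at key
  rw [ae_restrict_iff' hU.measurableSet]
  filter_upwards [key] with x hx hxU hx0
  have h1 := hx ⟨hxU, hx0⟩
  have h2 : fderiv ℝ f x = 0 ∨ v = 0 := by simpa using h1
  rcases h2 with h | h <;> simp [h]

/-- A function that is differentiable in the interior of a closed set and vanishes at its boundary
and at infinity has a directional derivative of integral zero, if that derivative is integrable. -/
theorem integral_fderiv_eq_zero_of_vanishes {Θ : Set E} (hΘ : IsClosed Θ) {G : E → ℝ}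
    (hG : ∀ x ∈ interior Θ, DifferentiableAt ℝ G x)
    (hb : ∀ x ∈ frontier Θ, Tendsto G (𝓝[Θ \ {x}] x) (𝓝 0))
    (hinf : Tendsto G (cocompact E ⊓ 𝓟 Θ) (𝓝 0)) (v : E)
    (hint : IntegrableOn (fun x => fderiv ℝ G x v) (interior Θ) μ) :
    ∫ x in interior Θ, fderiv ℝ G x v ∂μ = 0 := by
  classical
  set U := interior Θ with hUdef
  have hUo : IsOpen U := isOpen_interior
  -- `H c` is the cut-off of the extension of `G` by zero. It vanishes near every point outside `U`,
  -- hence is differentiable on all of `E`. As `c` grows the cut-off disappears wherever `G ≠ 0`.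
  let H : ℝ → E → ℝ := fun c x => softTrunc c (U.indicator G x)
  let H' : ℝ → E → ℝ := fun c x => U.indicator (fun x => truncWeight (c * G x) * fderiv ℝ G x v) x
  have small : ∀ c : ℝ, 0 < c → ∀ l : Filter E, Tendsto G l (𝓝 0) →
      ∀ᶠ y in l, |c * G y| ≤ 1 := by
    intro c hc l hl
    have h1 : Tendsto (fun y => |c * G y|) l (𝓝 |c * 0|) := (hl.const_mul c).abs
    rw [mul_zero, abs_zero] at h1
    exact (h1.eventually_lt_const zero_lt_one).mono fun y hy => hy.le
  have Hzero : ∀ c y, (y ∈ U → |c * G y| ≤ 1) → H c y = 0 := by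
    intro c y hy
    refine softTrunc_eq_zero ?_
    by_cases hyU : y ∈ U
    · simpa [hyU] using hy hyU
    · simp [hyU]
  have Hev : ∀ c : ℝ, 0 < c → ∀ x ∉ U, H c =ᶠ[𝓝 x] 0 := by
    intro c hc x hx
    by_cases hxΘ : x ∈ Θ
    · have hfr : x ∈ frontier Θ := by rw [hΘ.frontier_eq]; exact ⟨hxΘ, hx⟩
      have h1 := small c hc _ (hb x hfr)
      rw [eventually_nhdsWithin_iff] at h1
      filter_upwards [h1] with y hy
      exact Hzero c y fun hyU => hy ⟨interior_subset hyU, fun h => hx (h ▸ hyU)⟩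
    · filter_upwards [hΘ.isOpen_compl.mem_nhds hxΘ] with y hy
      exact Hzero c y fun hyU => absurd (interior_subset hyU) hy
  have HderivU : ∀ c x, x ∈ U →
      HasFDerivAt (H c) (truncWeight (c * G x) • fderiv ℝ G x) x := by
    intro c x hx
    have h1 := (hasDerivAt_softTrunc c (G x)).comp_hasFDerivAt x (hG x hx).hasFDerivAt
    refine h1.congr_of_eventuallyEq ?_
    filter_upwards [hUo.mem_nhds hx] with y hy
    simp [H, hy]
  have Hdiff : ∀ c : ℝ, 0 < c → Differentiable ℝ (H c) := by
    intro c hc x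
    by_cases hx : x ∈ U
    · exact (HderivU c x hx).differentiableAt
    · exact (differentiableAt_const (0 : ℝ)).congr_of_eventuallyEq (Hev c hc x hx)
  have Hderiv : ∀ c : ℝ, 0 < c → ∀ x, fderiv ℝ (H c) x v = H' c x := by
    intro c hc x
    by_cases hx : x ∈ U
    · simp [(HderivU c x hx).fderiv, H', hx]
    · rw [(Hev c hc x hx).fderiv_eq]
      simp [H', hx]
  have Hcs : ∀ c : ℝ, 0 < c → HasCompactSupport (H c) := by
    intro c hc
    have h1 := small c hc _ hinf
    rw [eventually_inf_principal] at h1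
    obtain ⟨K, hK, hKs⟩ := mem_cocompact.1 h1
    exact HasCompactSupport.intro hK fun x hx =>
      Hzero c x fun hxU => hKs hx (interior_subset hxU)
  have hbound : Integrable (U.indicator fun x => ‖fderiv ℝ G x v‖) μ :=
    (integrable_indicator_iff hUo.measurableSet).2 hint.norm
  have hle : ∀ c x, ‖H' c x‖ ≤ U.indicator (fun x => ‖fderiv ℝ G x v‖) x := by
    intro c x
    by_cases hx : x ∈ U
    · simp only [H', hx, Set.indicator_of_mem, norm_mul]
      refine mul_le_of_le_one_left (norm_nonneg _) ?_
      rw [Real.norm_of_nonneg (truncWeight_nonneg _)]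
      exact truncWeight_le_one _
    · simp [H', hx]
  have Hmeas : ∀ c : ℝ, 0 < c → AEStronglyMeasurable (H' c) μ := by
    intro c hc
    have : H' c = fun x => fderiv ℝ (H c) x v := funext fun x => (Hderiv c hc x).symm
    rw [this]
    exact (measurable_fderiv_apply_const ℝ (H c) v).aestronglyMeasurable
  have Hint : ∀ c : ℝ, 0 < c → ∫ x, H' c x ∂μ = 0 := by
    intro c hc
    have hi : Integrable (H' c) μ := hbound.mono' (Hmeas c hc) (ae_of_all _ (hle c))
    -- Integration by parts against the constant 1.
    have h := integral_mul_fderiv_eq_neg_fderiv_mul_of_integrable (μ := μ) (𝕜 := ℝ)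
      (f := fun _ => (1 : ℝ)) (g := H c) (v := v) (by simp)
      (by simpa only [one_mul, Hderiv c hc] using hi)
      (by simpa using (Hdiff c hc).continuous.integrable_of_hasCompactSupport (Hcs c hc))
      (fun x _ => differentiableAt_const _) (fun x _ => Hdiff c hc x)
    simpa [Hderiv c hc] using h
  have hlim : Tendsto (fun n : ℕ => ∫ x, H' ((n : ℝ) + 1) x ∂μ) atTop
      (𝓝 (∫ x, U.indicator (fun x => fderiv ℝ G x v) x ∂μ)) := by
    refine tendsto_integral_of_dominated_convergence _ (fun n => Hmeas _ (by positivity)) hbound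
      (fun n => ae_of_all _ (hle _)) ?_
    -- Where `G = 0` the weight is 0 for every `c`, so the pointwise limit is right only because the
    -- derivative of `G` also vanishes there almost everywhere.
    have h0 := ae_fderiv_eq_zero_of_eq_zero (μ := μ) hUo hG v
    rw [ae_restrict_iff' hUo.measurableSet] at h0
    filter_upwards [h0] with x hx
    by_cases hxU : x ∈ U
    · simp only [H', hxU, Set.indicator_of_mem]
      by_cases hx0 : G x = 0
      · simp [hx hxU hx0]
      · have hev : ∀ᶠ n : ℕ in atTop, truncWeight (((n : ℝ) + 1) * G x) = 1 := by
          obtain ⟨N, hN⟩ := exists_nat_ge (2 / |G x|)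
          filter_upwards [eventually_ge_atTop N] with n hn
          refine truncWeight_eq_one ?_
          have hpos : 0 < |G x| := abs_pos.2 hx0
          rw [abs_mul, abs_of_pos (by positivity : (0 : ℝ) < n + 1)]
          rw [div_le_iff₀ hpos] at hN
          have : (N : ℝ) ≤ n := by exact_mod_cast hn
          nlinarith
        refine tendsto_const_nhds.congr' ?_
        filter_upwards [hev] with n hn
        rw [hn, one_mul]
    · simp [H', hxU]
  rw [integral_indicator hUo.measurableSet] at hlim
  refine tendsto_nhds_unique hlim ?_
  simp only [Hint _ (by positivity : (0 : ℝ) < (_ : ℕ) + 1)]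
  exact tendsto_const_nhds

/-- If a directional derivative vanishes almost everywhere on an open set, then the function is
locally constant in that direction. -/
theorem eq_of_ae_fderiv_eq_zero {U : Set E} (hU : IsOpen U) {f : E → ℝ}
    (hf : ∀ x ∈ U, DifferentiableAt ℝ f x) {v : E}
    (h0 : ∀ᵐ x ∂μ.restrict U, fderiv ℝ f x v = 0) {x : E} {r : ℝ} (hr : 0 < r)
    (hball : Metric.ball x (2 * r) ⊆ U) (hv : ‖v‖ < r) : f (x + v) = f x := by
  have hcont : ContinuousOn f U := fun x hx => (hf x hx).continuousAt.continuousWithinAt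
  have hsub : ∀ y ∈ Metric.ball x r, ∀ t ∈ Set.Icc (0 : ℝ) 1, y + t • v ∈ U := by
    intro y hy t ht
    refine hball ?_
    rw [mem_ball_iff_norm] at hy ⊢
    have h1 : ‖t • v‖ ≤ ‖v‖ := by
      rw [norm_smul, Real.norm_of_nonneg ht.1]
      exact mul_le_of_le_one_left (norm_nonneg _) ht.2
    calc ‖y + t • v - x‖ = ‖(y - x) + t • v‖ := by congr 1; abel
      _ ≤ ‖y - x‖ + ‖t • v‖ := norm_add_le _ _
      _ < 2 * r := by linarith
  rw [ae_restrict_iff' hU.measurableSet] at h0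
  -- Translates of a null set are null, so by Fubini almost every line in direction `v` meets the
  -- exceptional set in a null set of times.
  have hlines : ∀ᵐ y ∂μ, ∀ᵐ t : ℝ, y + t • v ∈ U → fderiv ℝ f (y + t • v) v = 0 := by
    obtain ⟨B, hBsub, hBm, hB0⟩ := exists_measurable_superset_of_null (ae_iff.1 h0)
    have hqm : ∀ᵐ z : ℝ × E ∂(volume.prod μ), z.2 + z.1 • v ∉ B := by
      have hms : MeasurableSet {z : ℝ × E | z.2 + z.1 • v ∈ B} :=
        (by fun_prop : Measurable fun z : ℝ × E => z.2 + z.1 • v) hBm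
      rw [ae_iff]
      simp only [not_not]
      rw [Measure.measure_prod_null hms]
      refine ae_of_all _ fun t => ?_
      change μ ((fun y => y + t • v) ⁻¹' B) = 0
      rw [measure_preimage_add_right]
      exact hB0
    have h2 := (Measure.measurePreserving_swap (μ := μ) (ν := (volume : Measure ℝ)))
      |>.quasiMeasurePreserving.ae hqm
    filter_upwards [Measure.ae_ae_of_ae_prod h2] with y hy
    filter_upwards [hy] with t ht htU
    by_contra hne
    exact ht (hBsub fun hh => hne (hh htU))
  have hae : ∀ᵐ y ∂μ.restrict (Metric.ball x r), f (y + v) = f y := by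
    rw [ae_restrict_iff' Metric.isOpen_ball.measurableSet]
    filter_upwards [hlines] with y hy hyb
    have hd : ∀ t ∈ Set.uIcc (0 : ℝ) 1,
        HasDerivAt (fun t : ℝ => f (y + t • v)) (fderiv ℝ f (y + t • v) v) t := by
      intro t ht
      rw [Set.uIcc_of_le zero_le_one] at ht
      have h1 := (hf _ (hsub y hyb t ht)).hasFDerivAt
      have h2 : HasDerivAt (fun t : ℝ => y + t • v) v t := by
        simpa using ((hasDerivAt_id t).smul_const v).const_add y
      exact h1.comp_hasDerivAt t h2
    have hz : ∀ᵐ t : ℝ, t ∈ Set.uIoc (0 : ℝ) 1 → fderiv ℝ f (y + t • v) v = 0 := by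
      filter_upwards [hy] with t ht ht1
      rw [Set.uIoc_of_le zero_le_one] at ht1
      exact ht (hsub y hyb t ⟨ht1.1.le, ht1.2⟩)
    -- The derivative need not be continuous; being zero almost everywhere makes it integrable, as
    -- the fundamental theorem of calculus requires.
    have hii : IntervalIntegrable (fun t : ℝ => fderiv ℝ f (y + t • v) v) volume 0 1 := by
      rw [intervalIntegrable_iff]
      refine (integrable_zero ℝ ℝ _).congr ?_
      rw [EventuallyEq, ae_restrict_iff' measurableSet_uIoc]
      filter_upwards [hz] with t ht ht1
      exact (ht ht1).symm
    have h3 := intervalIntegral.integral_eq_sub_of_hasDerivAt hd hii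
    rw [intervalIntegral.integral_zero_ae hz] at h3
    simpa using (sub_eq_zero.1 h3.symm)
  have hc1 : ContinuousOn (fun y => f (y + v)) (Metric.ball x r) := by
    refine hcont.comp (by fun_prop) fun y hy => ?_
    simpa using hsub y hy 1 (by simp)
  have hc2 : ContinuousOn f (Metric.ball x r) := hcont.mono fun y hy => by
    simpa using hsub y hy 0 (by simp)
  exact Measure.eqOn_open_of_ae_eq hae Metric.isOpen_ball hc1 hc2 (Metric.mem_ball_self hr)

end Analysis

/-- A set all of whose points are isolated in it is countable. -/
lemma countable_of_forall_eventually_notMem {X : Type*} [TopologicalSpace X]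
    [SecondCountableTopology X] {s : Set X} (h : ∀ x ∈ s, ∀ᶠ y in 𝓝 x, y ∈ s → y = x) :
    s.Countable := by
  have hd : DiscreteTopology s := by
    rw [discreteTopology_subtype_iff]
    intro x hx
    have h1 : ∀ᶠ y in 𝓝[≠] x ⊓ 𝓟 s, False := by
      rw [eventually_inf_principal, eventually_nhdsWithin_iff]
      filter_upwards [h x hx] with y hy hne hys using hne (hy hys)
    simpa using h1
  exact (HereditarilyLindelofSpace.isLindelof s).countable hd

/-! ### Empirical means and laws of large numbers -/

section EmpiricalMean

variable {D : Type*}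

/-- The empirical mean of `f` over the first `N` samples. -/
noncomputable def empMean (z : ℕ → D) (N : ℕ) (f : D → ℝ) : ℝ :=
  (1 / (N : ℝ)) * ∑ n ∈ Finset.range N, f (z n)

lemma empMean_sub (z : ℕ → D) (N : ℕ) (f g : D → ℝ) :
    empMean z N (fun x => f x - g x) = empMean z N f - empMean z N g := by
  simp [empMean, Finset.sum_sub_distrib, mul_sub]

lemma abs_empMean_le (z : ℕ → D) (N : ℕ) {f g : D → ℝ} (h : ∀ n, |f (z n)| ≤ g (z n)) :
    |empMean z N f| ≤ empMean z N g := by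
  rw [empMean, empMean, abs_mul, abs_of_nonneg (by positivity : (0 : ℝ) ≤ 1 / N)]
  exact mul_le_mul_of_nonneg_left
    ((Finset.abs_sum_le_sum_abs _ _).trans (Finset.sum_le_sum fun n _ => h n)) (by positivity)

end EmpiricalMean

section LargeNumbers

variable {Ω D : Type*} [MeasurableSpace Ω] [MeasurableSpace D] {P : Measure Ω}
  {μ : Measure D} {Z : ℕ → Ω → D}

lemma ae_forall_sample {p : D → Prop} (hZ : ∀ n, Measurable (Z n)) (hlaw : ∀ n, P.map (Z n) = μ)
    (h : ∀ᵐ z ∂μ, p z) : ∀ᵐ ω ∂P, ∀ n, p (Z n ω) :=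
  ae_all_iff.2 fun n => ae_of_ae_map (hZ n).aemeasurable ((hlaw n).symm ▸ h)

theorem ae_tendsto_empMean (hZ : ∀ n, Measurable (Z n)) (hind : iIndepFun Z P)
    (hlaw : ∀ n, P.map (Z n) = μ) {f : D → ℝ} (hf : Integrable f μ) :
    ∀ᵐ ω ∂P, Tendsto (fun N => empMean (fun n => Z n ω) N f) atTop (𝓝 (∫ z, f z ∂μ)) := by
  have hfm : ∀ n, AEMeasurable f (P.map (Z n)) := fun n => by
    rw [hlaw n]; exact hf.aemeasurable
  have h := strong_law_ae_real (μ := P) (fun n => f ∘ Z n)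
    ((integrable_map_measure (by rw [hlaw]; exact hf.aestronglyMeasurable)
      (hZ 0).aemeasurable).1 (by rw [hlaw]; exact hf))
    (fun i j hij => (hind.indepFun hij).comp₀ (hZ i).aemeasurable (hZ j).aemeasurable
      (hfm i) (hfm j))
    (fun i => (IdentDistrib.mk (hZ i).aemeasurable (hZ 0).aemeasurable
      (by rw [hlaw, hlaw])).comp_of_aemeasurable (hfm i))
  have hE : ∫ ω, (f ∘ Z 0) ω ∂P = ∫ z, f z ∂μ := by
    rw [← hlaw 0, integral_map (hZ 0).aemeasurable (by rw [hlaw]; exact hf.aestronglyMeasurable)]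
    rfl
  rw [hE] at h
  filter_upwards [h] with ω hω
  refine hω.congr fun N => ?_
  simp [empMean, div_eq_inv_mul]

/-- The uniform law of large numbers for a family of functions that is indexed by a compact set
and Lipschitz in the index with an integrable Lipschitz constant. -/
theorem ae_tendsto_empMean_sub_integral {W : Type*} [NormedAddCommGroup W] {S : Set W}
    (hS : IsCompact S) (hZ : ∀ n, Measurable (Z n)) (hind : iIndepFun Z P)
    (hlaw : ∀ n, P.map (Z n) = μ) {f : D → W → ℝ} (hf : ∀ w ∈ S, Integrable (fun z => f z w) μ)
    {L : D → ℝ} (hL : Integrable L μ)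
    (hlip : ∀ᵐ z ∂μ, ∀ w₁ ∈ S, ∀ w₂ ∈ S, |f z w₁ - f z w₂| ≤ L z * ‖w₁ - w₂‖) :
    ∀ᵐ ω ∂P, ∀ u : ℕ → W, (∀ᶠ N in atTop, u N ∈ S) →
      Tendsto (fun N => empMean (fun n => Z n ω) N (fun z => f z (u N)) - ∫ z, f z (u N) ∂μ)
        atTop (𝓝 0) := by
  have hcover : ∀ j : ℕ, ∃ t ⊆ S, t.Finite ∧ S ⊆ ⋃ x ∈ t, Metric.ball x (1 / ((j : ℝ) + 1)) :=
    fun j => hS.finite_cover_balls (by positivity)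
  choose t htS htf htc using hcover
  -- Only the countably many net points enter the almost sure event. It is fixed before `u` is
  -- chosen, so `u` may depend on the sample.
  have h1 : ∀ᵐ ω ∂P, ∀ j, ∀ y ∈ t j, Tendsto
      (fun N => empMean (fun n => Z n ω) N (fun z => f z y)) atTop (𝓝 (∫ z, f z y ∂μ)) := by
    rw [ae_all_iff]
    intro j
    rw [ae_ball_iff (htf j).countable]
    exact fun y hy => ae_tendsto_empMean hZ hind hlaw (hf y (htS j hy))
  have hlip' : ∀ᵐ z ∂μ, ∀ w₁ ∈ S, ∀ w₂ ∈ S, |f z w₁ - f z w₂| ≤ |L z| * ‖w₁ - w₂‖ := by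
    filter_upwards [hlip] with z hz w₁ h₁ w₂ h₂
    exact (hz w₁ h₁ w₂ h₂).trans (mul_le_mul_of_nonneg_right (le_abs_self _) (norm_nonneg _))
  filter_upwards [h1, ae_tendsto_empMean hZ hind hlaw hL.abs, ae_forall_sample hZ hlaw hlip']
    with ω h1 h2 h3 u hu
  set C := ∫ z, |L z| ∂μ with hC
  have hC0 : 0 ≤ C := integral_nonneg fun z => abs_nonneg _
  rw [Metric.tendsto_nhds]
  intro ε hε
  -- The three errors are at most `δ (C + 1)`, `ε / 2` and `δ C`; this choice makes `δ (2 C + 1) < ε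
  -- / 2`.
  obtain ⟨j, hj⟩ := exists_nat_gt ((2 * C + 1) * 2 / ε)
  set δ : ℝ := 1 / ((j : ℝ) + 1) with hδdef
  have hδ : 0 < δ := by positivity
  have hδε : δ * (2 * C + 1) < ε / 2 := by
    rw [div_lt_iff₀ hε] at hj
    rw [hδdef, div_mul_eq_mul_div, one_mul, div_lt_iff₀ (by positivity)]
    nlinarith
  have hev1 : ∀ᶠ N in atTop, empMean (fun n => Z n ω) N (fun z => |L z|) < C + 1 :=
    h2.eventually_lt_const (by linarith)
  have hev2 : ∀ᶠ N in atTop, ∀ y ∈ t j,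
      |empMean (fun n => Z n ω) N (fun z => f z y) - ∫ z, f z y ∂μ| < ε / 2 := by
    rw [eventually_all_finite (htf j)]
    intro y hy
    exact (Metric.tendsto_nhds.1 (h1 j y hy) (ε / 2) (by positivity)).mono fun N hN => by
      simpa [Real.dist_eq] using hN
  filter_upwards [hev1, hev2, hu] with N hN1 hN2 hNu
  obtain ⟨y, hy, hyb⟩ : ∃ y ∈ t j, u N ∈ Metric.ball y δ := by
    simpa only [Set.mem_iUnion, exists_prop] using htc j hNu
  have hd : ‖u N - y‖ ≤ δ := (mem_ball_iff_norm.1 hyb).le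
  have hyS := htS j hy
  have e1 : |empMean (fun n => Z n ω) N (fun z => f z (u N))
      - empMean (fun n => Z n ω) N (fun z => f z y)|
      ≤ δ * empMean (fun n => Z n ω) N (fun z => |L z|) := by
    rw [← empMean_sub]
    refine (abs_empMean_le _ _ (g := fun z => |L z| * δ) fun n =>
      (h3 n _ hNu _ hyS).trans (mul_le_mul_of_nonneg_left hd (abs_nonneg _))).trans_eq ?_
    simp only [empMean, ← Finset.sum_mul]
    ring
  have e2 : |(∫ z, f z (u N) ∂μ) - ∫ z, f z y ∂μ| ≤ δ * C := by
    rw [← integral_sub (hf _ hNu) (hf _ hyS), hC, ← integral_const_mul, ← Real.norm_eq_abs]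
    refine norm_integral_le_of_norm_le (hL.abs.const_mul δ) ?_
    filter_upwards [hlip'] with z hz
    rw [Real.norm_eq_abs, mul_comm]
    exact (hz _ hNu _ hyS).trans (mul_le_mul_of_nonneg_left hd (abs_nonneg _))
  have e3 := hN2 y hy
  have e4 : δ * empMean (fun n => Z n ω) N (fun z => |L z|) ≤ δ * (C + 1) :=
    mul_le_mul_of_nonneg_left hN1.le hδ.le
  rw [Real.dist_eq, sub_zero]
  rw [abs_le] at e1 e2
  rw [abs_lt] at e3 ⊢
  constructor <;> nlinarith [e1.1, e1.2, e2.1, e2.2, e3.1, e3.2]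

end LargeNumbers

/-! ### Positive definiteness and inverses of matrices -/

section Matrices

variable {p : ℕ}

lemma dotProduct_outer_mulVec (v : Vec p) (a : Fin p → ℝ) :
    a ⬝ᵥ (outer v).mulVec a = (∑ i, a i * v i) ^ 2 := by
  simp only [dotProduct, Matrix.mulVec, outer, Matrix.of_apply, sq, Finset.sum_mul, Finset.mul_sum]
  refine Finset.sum_congr rfl fun i _ => Finset.sum_congr rfl fun j _ => ?_
  ring

lemma posSemidef_outer (v : Vec p) : (outer v).PosSemidef := by
  refine Matrix.PosSemidef.of_dotProduct_mulVec_nonneg ?_ fun a => ?_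
  · ext i j
    simp [outer, mul_comm]
  · rw [star_trivial, dotProduct_outer_mulVec]
    positivity

lemma abs_entry_le_frobNorm (A : Matrix (Fin p) (Fin p) ℝ) (i j : Fin p) :
    |A i j| ≤ frobNorm A := by
  refine Real.abs_le_sqrt ?_
  calc A i j ^ 2 ≤ ∑ j, A i j ^ 2 :=
        Finset.single_le_sum (f := fun j => A i j ^ 2) (fun j _ => sq_nonneg _) (Finset.mem_univ j)
    _ ≤ _ := Finset.single_le_sum (f := fun i => ∑ j, A i j ^ 2)
        (fun i _ => Finset.sum_nonneg fun j _ => sq_nonneg _) (Finset.mem_univ i)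

/-- Positive semidefinite matrices that converge to a positive definite matrix are eventually
positive definite, and their inverses converge. -/
lemma eventually_posDef_and_tendsto_inv {A : ℕ → Matrix (Fin p) (Fin p) ℝ}
    {B : Matrix (Fin p) (Fin p) ℝ} (hA : ∀ N, (A N).PosSemidef) (hB : B.PosDef)
    (h : Tendsto A atTop (𝓝 B)) :
    (∀ᶠ N in atTop, (A N).PosDef) ∧ Tendsto (fun N => (A N)⁻¹) atTop (𝓝 B⁻¹) := by
  -- For positive semidefinite matrices, definiteness means nonzero determinant, which is an open
  -- condition.
  have hdet : B.det ≠ 0 := hB.posSemidef.posDef_iff_det_ne_zero.1 hB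
  constructor
  · have h1 : Tendsto (fun N => (A N).det) atTop (𝓝 B.det) :=
      ((continuous_id.matrix_det).tendsto B).comp h
    filter_upwards [h1.eventually_ne hdet] with N hN
    exact (hA N).posDef_iff_det_ne_zero.2 hN
  · have hinv : ContinuousAt Ring.inverse B.det := by
      rw [Ring.inverse_eq_inv']
      exact continuousAt_inv₀ hdet
    exact (continuousAt_matrix_inv B hinv).tendsto.comp h

end Matrices

lemma ae_ae_swap_of_ae_prod {α β : Type*} [MeasurableSpace α] [MeasurableSpace β] {μ : Measure α}
    {ν : Measure β} [SFinite μ] [SFinite ν] {q : α × β → Prop} (h : ∀ᵐ z ∂μ.prod ν, q z) :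
    ∀ᵐ y ∂ν, ∀ᵐ x ∂μ, q (x, y) :=
  Measure.ae_ae_of_ae_prod
    ((Measure.measurePreserving_swap (μ := ν) (ν := μ)).quasiMeasurePreserving.ae h)

/-! ### Integration against a joint density -/

section JointLaw

variable {p : ℕ} {X : Type*} [MeasurableSpace X] {Θ : Set (Vec p)} {ν : Measure X}
  {q : Vec p → X → ℝ}

lemma ae_jointLaw_iff (hq : Measurable (Function.uncurry q)) {r : Vec p × X → Prop} :
    (∀ᵐ z ∂(jointLaw Θ ν q), r z) ↔
      ∀ᵐ z ∂((volume.restrict Θ).prod ν), 0 < q z.1 z.2 → r z := by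
  have hm : Measurable fun z : Vec p × X => ENNReal.ofReal (q z.1 z.2) := hq.ennreal_ofReal
  rw [jointLaw, ae_withDensity_iff hm]
  simp

/-- Nonnegativity is required because `ENNReal.ofReal` in the law clips negative values of `q`. -/
lemma integrable_jointLaw_iff (hq : Measurable (Function.uncurry q))
    (h0 : ∀ᵐ z ∂((volume.restrict Θ).prod ν), 0 ≤ q z.1 z.2) {f : Vec p × X → ℝ} :
    Integrable f (jointLaw Θ ν q) ↔
      Integrable (fun z => q z.1 z.2 * f z) ((volume.restrict Θ).prod ν) := by
  have hm : Measurable fun z : Vec p × X => ENNReal.ofReal (q z.1 z.2) := hq.ennreal_ofReal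
  rw [jointLaw, integrable_withDensity_iff_integrable_smul' hm
    (ae_of_all _ fun z => ENNReal.ofReal_lt_top)]
  refine integrable_congr ?_
  filter_upwards [h0] with z hz
  simp [ENNReal.toReal_ofReal hz]

lemma integral_jointLaw (hq : Measurable (Function.uncurry q))
    (h0 : ∀ᵐ z ∂((volume.restrict Θ).prod ν), 0 ≤ q z.1 z.2) (f : Vec p × X → ℝ) :
    ∫ z, f z ∂(jointLaw Θ ν q) = ∫ z, q z.1 z.2 * f z ∂((volume.restrict Θ).prod ν) := by
  have hm : Measurable fun z : Vec p × X => ENNReal.ofReal (q z.1 z.2) := hq.ennreal_ofReal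
  rw [jointLaw, integral_withDensity_eq_integral_toReal_smul hm
    (ae_of_all _ fun z => ENNReal.ofReal_lt_top)]
  refine integral_congr_ae ?_
  filter_upwards [h0] with z hz
  simp [ENNReal.toReal_ofReal hz]

end JointLaw

/-! ### Support of the model, evidence and posterior -/

namespace BayesModel

variable {p d : ℕ} {M : BayesModel p d} {m : ℕ}

instance : SigmaFinite M.obsMeasure := by unfold obsMeasure; infer_instance

instance : SigmaFinite (M.obsSetMeasure m) := by unfold obsSetMeasure; infer_instance

lemma isClosed_Θ (M : BayesModel p d) : IsClosed M.Θ := M.perfect_Θ.closed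

lemma measurable_joint (M : BayesModel p d) : Measurable (Function.uncurry M.joint) :=
  (M.measurable_prior.comp measurable_fst).mul M.measurable_lik

lemma measurable_jointSet (M : BayesModel p d) (m : ℕ) :
    Measurable (Function.uncurry (M.jointSet m)) := by
  refine (M.measurable_prior.comp measurable_fst).mul ?_
  refine Finset.measurable_prod _ fun j _ => ?_
  exact M.measurable_lik.comp
    (measurable_fst.prodMk ((measurable_pi_apply j).comp measurable_snd))

/-- The integral of a non-integrable function is 0 by convention, so normalization to 1 forces
integrability. -/
lemma integrable_lik {θ : Vec p} (hθ : θ ∈ M.Θ) : Integrable (M.lik θ) M.obsMeasure :=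
  Integrable.of_integral_ne_zero (by rw [obsMeasure, M.integral_lik θ hθ]; exact one_ne_zero)

lemma joint_nonneg {θ : Vec p} (hθ : θ ∈ M.Θ) {x : Vec d} (hx : x ∈ M.Υ) : 0 ≤ M.joint θ x :=
  mul_nonneg (M.prior_nonneg θ hθ) (M.lik_nonneg θ hθ x hx)

lemma jointSet_nonneg {θ : Vec p} (hθ : θ ∈ M.Θ) {x : Fin m → Vec d} (hx : ∀ j, x j ∈ M.Υ) :
    0 ≤ M.jointSet m θ x :=
  mul_nonneg (M.prior_nonneg θ hθ) (Finset.prod_nonneg fun j _ => M.lik_nonneg θ hθ _ (hx j))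

lemma ae_obsMeasure (M : BayesModel p d) : ∀ᵐ x ∂M.obsMeasure, x ∈ M.Υ :=
  ae_restrict_mem M.measurableSet_Υ

lemma ae_obsSetMeasure (M : BayesModel p d) (m : ℕ) :
    ∀ᵐ x ∂(M.obsSetMeasure m), ∀ j, x j ∈ M.Υ :=
  ae_all_iff.2 fun j => (Measure.quasiMeasurePreserving_eval (fun _ => M.obsMeasure) j).ae
    M.ae_obsMeasure

/-- The prior vanishes almost everywhere on the boundary of the parameter set. -/
lemma ae_frontier_prior_eq_zero (h : M.BCRBRegular) :
    ∀ᵐ θ ∂(volume.restrict (frontier M.Θ)), M.prior θ = 0 := by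
  -- Countable sets are Lebesgue null only in positive dimension; in dimension zero the frontier is
  -- empty.
  rcases Nat.eq_zero_or_pos p with rfl | hp
  · simp
  have : Nonempty (Fin p) := ⟨⟨0, hp⟩⟩
  have hfr : MeasurableSet (frontier M.Θ) := isClosed_frontier.measurableSet
  have hsub : frontier M.Θ ⊆ M.Θ := M.isClosed_Θ.frontier_subset
  have h1 : ∀ x ∈ M.Υ, ∀ᵐ θ ∂(volume.restrict (frontier M.Θ)), M.joint θ x = 0 := by
    intro x hx
    -- The limit at a frontier point is over a punctured neighbourhood, so points of the frontier
    -- with a value above `1 / (n + 1)` are isolated among themselves.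
    have hc : ∀ n : ℕ,
        {θ ∈ frontier M.Θ | 1 / ((n : ℝ) + 1) < ‖M.joint θ x • θ‖}.Countable := by
      intro n
      refine countable_of_forall_eventually_notMem fun θ₀ hθ₀ => ?_
      have h2 := ((h.boundary x hx).1 θ₀ hθ₀.1).norm
      rw [norm_zero] at h2
      have h3 := h2.eventually_lt_const (by positivity : (0 : ℝ) < 1 / ((n : ℝ) + 1))
      rw [eventually_nhdsWithin_iff] at h3
      filter_upwards [h3] with y hy hys
      by_contra hne
      exact (hy ⟨hsub hys.1, hne⟩).not_gt hys.2
    have hc' : (⋃ n : ℕ, {θ ∈ frontier M.Θ | 1 / ((n : ℝ) + 1) < ‖M.joint θ x • θ‖}).Countable :=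
      Set.countable_iUnion hc
    rw [ae_restrict_iff' hfr]
    -- The origin is discarded since the condition on `θ p(x, θ)` carries no information at `θ = 0`.
    filter_upwards [measure_eq_zero_iff_ae_notMem.1 (hc'.measure_zero volume),
      measure_eq_zero_iff_ae_notMem.1 ((Set.countable_singleton (0 : Vec p)).measure_zero volume)]
      with θ hθ hθ0 hθfr
    by_contra hne
    have hpos : 0 < ‖M.joint θ x • θ‖ := norm_pos_iff.2 (smul_ne_zero hne hθ0)
    obtain ⟨n, hn⟩ := exists_nat_one_div_lt hpos
    exact hθ (Set.mem_iUnion.2 ⟨n, hθfr, hn⟩)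
  have h2 : ∀ᵐ θ ∂(volume.restrict (frontier M.Θ)), ∀ᵐ x ∂M.obsMeasure, M.joint θ x = 0 := by
    have hms : MeasurableSet {z : Vec p × Vec d | M.joint z.1 z.2 = 0} :=
      M.measurable_joint (measurableSet_singleton 0)
    rw [Measure.ae_ae_comm hms]
    filter_upwards [M.ae_obsMeasure] with x hx using h1 x hx
  filter_upwards [h2, ae_restrict_mem hfr] with θ hθ hθfr
  by_contra hne
  have h3 : ∫ x in M.Υ, M.lik θ x = 0 := by
    refine integral_eq_zero_of_ae ?_
    filter_upwards [hθ] with x hx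
    exact (mul_eq_zero.1 hx).resolve_left hne
  rw [M.integral_lik θ (hsub hθfr)] at h3
  exact one_ne_zero h3

/-- This confines all later integrals to the interior, where the differentiability hypotheses apply,
even if the frontier has positive measure. -/
lemma ae_mem_interior (h : M.BCRBRegular) :
    ∀ᵐ θ ∂(volume.restrict M.Θ), M.prior θ ≠ 0 → θ ∈ interior M.Θ := by
  have h1 := ae_frontier_prior_eq_zero h
  rw [ae_restrict_iff' isClosed_frontier.measurableSet] at h1
  rw [ae_restrict_iff' M.isClosed_Θ.measurableSet]
  filter_upwards [h1] with θ hθ hθΘ hne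
  by_contra hint
  exact hne (hθ (M.isClosed_Θ.frontier_eq ▸ ⟨hθΘ, hint⟩))

/-- `A` is the set of observations of positive likelihood, for every interior parameter. -/
def IsCommonSupport (M : BayesModel p d) (A : Set (Vec d)) : Prop :=
  (∀ θ ∈ interior M.Θ, 0 < M.prior θ) ∧
    ∀ θ ∈ interior M.Θ, ∀ x ∈ M.Υ, (x ∈ A → 0 < M.lik θ x) ∧ (x ∉ A → M.lik θ x = 0)

lemma nonempty_interior (h : M.BCRBRegular) : (interior M.Θ).Nonempty := by
  by_contra hne
  rw [Set.not_nonempty_iff_eq_empty] at hne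
  have h1 : ∫ θ in M.Θ, M.prior θ = 0 := by
    refine integral_eq_zero_of_ae ?_
    filter_upwards [ae_mem_interior h] with θ hθ
    by_contra h0
    simpa [hne] using hθ h0
  rw [M.integral_prior] at h1
  exact one_ne_zero h1

/-- If the prior vanished at one interior point, the common support would be empty, and so the joint
density would vanish at all interior parameters. Normalization of the likelihood and then of the
prior excludes this. With a positive prior, the support of the joint density is that of the
likelihood. -/
lemma exists_isCommonSupport (h : M.BCRBRegular) : ∃ A, M.IsCommonSupport A := by
  obtain ⟨A, -, hA⟩ := h.common_support
  have hmem : ∀ θ ∈ interior M.Θ, ∀ x ∈ M.Υ, 0 < M.joint θ x ↔ x ∈ A := by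
    intro θ hθ x hx
    rw [← hA θ hθ]
    simp [hx]
  have hprior : ∀ θ ∈ interior M.Θ, 0 < M.prior θ := by
    intro θ hθ
    refine lt_of_le_of_ne (M.prior_nonneg θ (interior_subset hθ)) fun h0 => ?_
    have hAe : A = ∅ := by
      rw [← hA θ hθ]
      simp [joint, ← h0]
    have h1 : ∫ t in M.Θ, M.prior t = 0 := by
      refine integral_eq_zero_of_ae ?_
      filter_upwards [ae_mem_interior h] with t ht
      by_contra hne
      have htint := ht hne
      have h2 : ∫ x in M.Υ, M.lik t x = 0 := by
        refine integral_eq_zero_of_ae ?_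
        filter_upwards [ae_restrict_mem M.measurableSet_Υ] with x hx
        have h3 := (hmem t htint x hx).not.2 (by simp [hAe])
        have h4 := joint_nonneg (interior_subset htint) hx
        exact (mul_eq_zero.1 (le_antisymm (not_lt.1 h3) h4)).resolve_left hne
      rw [M.integral_lik t (interior_subset htint)] at h2
      exact one_ne_zero h2
    rw [M.integral_prior] at h1
    exact one_ne_zero h1
  refine ⟨A, hprior, fun θ hθ x hx => ⟨fun hxA => ?_, fun hxA => ?_⟩⟩
  · exact (pos_iff_pos_of_mul_pos ((hmem θ hθ x hx).2 hxA)).1 (hprior θ hθ)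
  · have h1 := not_lt.1 ((hmem θ hθ x hx).not.2 hxA)
    have h2 := le_antisymm h1 (joint_nonneg (interior_subset hθ) hx)
    exact (mul_eq_zero.1 h2).resolve_left (hprior θ hθ).ne'

variable {A : Set (Vec d)}

lemma IsCommonSupport.jointSet_pos (hA : M.IsCommonSupport A) {θ : Vec p} (hθ : θ ∈ interior M.Θ)
    {x : Fin m → Vec d} (hx : ∀ j, x j ∈ M.Υ) (hxA : ∀ j, x j ∈ A) : 0 < M.jointSet m θ x :=
  mul_pos (hA.1 θ hθ) (Finset.prod_pos fun j _ => (hA.2 θ hθ _ (hx j)).1 (hxA j))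

lemma IsCommonSupport.jointSet_eq_zero (hA : M.IsCommonSupport A) {θ : Vec p}
    (hθ : θ ∈ interior M.Θ) {x : Fin m → Vec d} (hx : ∀ j, x j ∈ M.Υ) (hxA : ¬ ∀ j, x j ∈ A) :
    M.jointSet m θ x = 0 := by
  obtain ⟨j, hj⟩ := not_forall.1 hxA
  rw [jointSet, Finset.prod_eq_zero (Finset.mem_univ j) ((hA.2 θ hθ _ (hx j)).2 hj), mul_zero]

lemma ae_prod_obsSetMeasure (h : M.BCRBRegular) (m : ℕ) :
    ∀ᵐ z ∂((volume.restrict M.Θ).prod (M.obsSetMeasure m)),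
      z.1 ∈ M.Θ ∧ (M.prior z.1 ≠ 0 → z.1 ∈ interior M.Θ) ∧ ∀ j, z.2 j ∈ M.Υ := by
  have h1 : ∀ᵐ z ∂((volume.restrict M.Θ).prod (M.obsSetMeasure m)), z.1 ∈ M.Θ :=
    Measure.quasiMeasurePreserving_fst.ae (ae_restrict_mem M.isClosed_Θ.measurableSet)
  have h2 : ∀ᵐ z ∂((volume.restrict M.Θ).prod (M.obsSetMeasure m)),
      M.prior z.1 ≠ 0 → z.1 ∈ interior M.Θ :=
    Measure.quasiMeasurePreserving_fst.ae (ae_mem_interior h)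
  have h3 : ∀ᵐ z ∂((volume.restrict M.Θ).prod (M.obsSetMeasure m)), ∀ j, z.2 j ∈ M.Υ :=
    Measure.quasiMeasurePreserving_snd.ae (M.ae_obsSetMeasure m)
  filter_upwards [h1, h2, h3] with z a b c using ⟨a, b, c⟩

lemma ae_prod_obsMeasure (h : M.BCRBRegular) :
    ∀ᵐ z ∂((volume.restrict M.Θ).prod M.obsMeasure),
      z.1 ∈ M.Θ ∧ (M.prior z.1 ≠ 0 → z.1 ∈ interior M.Θ) ∧ z.2 ∈ M.Υ := by
  have h1 : ∀ᵐ z ∂((volume.restrict M.Θ).prod M.obsMeasure), z.1 ∈ M.Θ :=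
    Measure.quasiMeasurePreserving_fst.ae (ae_restrict_mem M.isClosed_Θ.measurableSet)
  have h2 : ∀ᵐ z ∂((volume.restrict M.Θ).prod M.obsMeasure),
      M.prior z.1 ≠ 0 → z.1 ∈ interior M.Θ :=
    Measure.quasiMeasurePreserving_fst.ae (ae_mem_interior h)
  have h3 : ∀ᵐ z ∂((volume.restrict M.Θ).prod M.obsMeasure), z.2 ∈ M.Υ :=
    Measure.quasiMeasurePreserving_snd.ae M.ae_obsMeasure
  filter_upwards [h1, h2, h3] with z a b c using ⟨a, b, c⟩

lemma ae_jointSet_nonneg (h : M.BCRBRegular) (m : ℕ) :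
    ∀ᵐ z ∂((volume.restrict M.Θ).prod (M.obsSetMeasure m)), 0 ≤ M.jointSet m z.1 z.2 := by
  filter_upwards [ae_prod_obsSetMeasure h m] with z hz using jointSet_nonneg hz.1 hz.2.2

lemma ae_joint_nonneg (h : M.BCRBRegular) :
    ∀ᵐ z ∂((volume.restrict M.Θ).prod M.obsMeasure), 0 ≤ M.joint z.1 z.2 := by
  filter_upwards [ae_prod_obsMeasure h] with z hz using joint_nonneg hz.1 hz.2.2

/-- The marginal density of the observations. -/
noncomputable def evidence (M : BayesModel p d) (m : ℕ) (x : Fin m → Vec d) : ℝ :=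
  ∫ t in M.Θ, M.jointSet m t x

lemma ae_integrable_jointSet (h : M.BCRBRegular) [IsFiniteMeasure (M.lawSet m)] :
    ∀ᵐ x ∂(M.obsSetMeasure m), Integrable (fun θ => M.jointSet m θ x) (volume.restrict M.Θ) := by
  have h1 : Integrable (fun _ => (1 : ℝ)) (M.lawSet m) := integrable_const 1
  have h2 := (integrable_jointLaw_iff (M.measurable_jointSet m) (ae_jointSet_nonneg h m)).1 h1
  simp only [mul_one] at h2
  exact h2.prod_left_ae

/-- The integrand is positive on the nonempty open interior. Integrability matters, since otherwise
the integral would be 0 by convention. -/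
lemma IsCommonSupport.evidence_pos (hA : M.IsCommonSupport A) (h : M.BCRBRegular)
    {x : Fin m → Vec d} (hx : ∀ j, x j ∈ M.Υ) (hxA : ∀ j, x j ∈ A)
    (hint : Integrable (fun θ => M.jointSet m θ x) (volume.restrict M.Θ)) :
    0 < M.evidence m x := by
  have hn : 0 ≤ᵐ[volume.restrict M.Θ] fun θ => M.jointSet m θ x := by
    filter_upwards [ae_restrict_mem M.isClosed_Θ.measurableSet] with θ hθ
      using jointSet_nonneg hθ hx
  rw [evidence, integral_pos_iff_support_of_nonneg_ae hn hint]
  have h1 : (interior M.Θ) ⊆ Function.support fun θ => M.jointSet m θ x :=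
    fun θ hθ => (hA.jointSet_pos hθ hx hxA).ne'
  refine lt_of_lt_of_le ?_ (measure_mono h1)
  rw [Measure.restrict_eq_self _ interior_subset]
  exact isOpen_interior.measure_pos _ (nonempty_interior h)

/-- Almost surely, the parameter is interior, and the observations lie in the common support and
have positive evidence. -/
lemma ae_lawSet (h : M.BCRBRegular) (hA : M.IsCommonSupport A) [IsFiniteMeasure (M.lawSet m)] :
    ∀ᵐ z ∂(M.lawSet m), z.1 ∈ interior M.Θ ∧ (∀ j, z.2 j ∈ M.Υ) ∧ (∀ j, z.2 j ∈ A) ∧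
      0 < M.evidence m z.2 := by
  rw [lawSet, ae_jointLaw_iff (M.measurable_jointSet m)]
  have h1 : ∀ᵐ z ∂((volume.restrict M.Θ).prod (M.obsSetMeasure m)),
      Integrable (fun θ => M.jointSet m θ z.2) (volume.restrict M.Θ) :=
    Measure.quasiMeasurePreserving_snd.ae (ae_integrable_jointSet h)
  filter_upwards [ae_prod_obsSetMeasure h m, h1] with z hz hi hpos
  have hzi : z.1 ∈ interior M.Θ := hz.2.1 fun h0 => by simp [jointSet, h0] at hpos
  have hzA : ∀ j, z.2 j ∈ A := by
    by_contra hne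
    exact hpos.ne' (hA.jointSet_eq_zero hzi hz.2.2 hne)
  exact ⟨hzi, hz.2.2, hzA, hA.evidence_pos h hz.2.2 hzA hi⟩

lemma IsCommonSupport.posterior_pos (hA : M.IsCommonSupport A) {θ : Vec p}
    (hθ : θ ∈ interior M.Θ) {x : Fin m → Vec d} (hx : ∀ j, x j ∈ M.Υ) (hxA : ∀ j, x j ∈ A)
    (he : 0 < M.evidence m x) : 0 < posterior M.Θ (M.jointSet m) θ x :=
  div_pos (hA.jointSet_pos hθ hx hxA) he

/-- Near an interior point, the log posterior and the log joint density differ by the constant log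
evidence. -/
lemma IsCommonSupport.postScore_eq (hA : M.IsCommonSupport A) {θ : Vec p}
    (hθ : θ ∈ interior M.Θ) {x : Fin m → Vec d} (hx : ∀ j, x j ∈ M.Υ) (hxA : ∀ j, x j ∈ A)
    (he : 0 < M.evidence m x) : M.postScore m θ x = score (M.jointSet m) θ x := by
  have h1 : (fun t => Real.log (posterior M.Θ (M.jointSet m) t x)) =ᶠ[𝓝 θ]
      fun t => Real.log (M.jointSet m t x) - Real.log (M.evidence m x) := by
    filter_upwards [isOpen_interior.mem_nhds hθ] with t ht
    exact Real.log_div (hA.jointSet_pos ht hx hxA).ne' he.ne'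
  rw [postScore, score, score, gradient, gradient, h1.fderiv_eq, fderiv_sub_const]

lemma F_B_apply (h : M.BCRBRegular) [IsFiniteMeasure (M.lawSet m)] (i j : Fin p) :
    M.F_B m i j = ∫ z, M.postScore m z.1 z.2 i * M.postScore m z.1 z.2 j ∂(M.lawSet m) := by
  obtain ⟨A, hA⟩ := exists_isCommonSupport h
  refine integral_congr_ae ?_
  have h1 := ae_lawSet (m := m) h hA
  rw [lawSet] at h1
  filter_upwards [h1] with z hz
  rw [hA.postScore_eq hz.1 hz.2.1 hz.2.2.1 hz.2.2.2]

end BayesModel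

/-! ### Second moments and coordinates of the score -/

section SecondMoment

variable {p : ℕ} {D : Type*} [MeasurableSpace D] {μ : Measure D} {g : D → Vec p}

lemma memLp_coord {e : ENNReal} (hg : MemLp g e μ) (i : Fin p) : MemLp (fun z => g z i) e μ :=
  (EuclideanSpace.proj (𝕜 := ℝ) i).comp_memLp' hg

lemma integrable_coord_mul {h : D → Vec p} (hg : MemLp g 2 μ) (hh : MemLp h 2 μ) (i j : Fin p) :
    Integrable (fun z => g z i * h z j) μ :=
  (memLp_coord hg i).integrable_mul (memLp_coord hh j)

lemma memLp_dotProduct (hg : MemLp g 2 μ) (a : Fin p → ℝ) :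
    MemLp (fun z => ∑ i, a i * g z i) 2 μ :=
  memLp_finsetSum _ fun i _ => (memLp_coord hg i).const_mul (a i)

/-- The quadratic form of a second moment matrix. -/
lemma dotProduct_secondMoment_mulVec (hg : MemLp g 2 μ) (a : Fin p → ℝ) :
    a ⬝ᵥ (Matrix.of fun i j => ∫ z, g z i * g z j ∂μ).mulVec a =
      ∫ z, (∑ i, a i * g z i) ^ 2 ∂μ := by
  have h1 : ∀ z, (∑ i, a i * g z i) ^ 2 = ∑ i, ∑ j, a i * a j * (g z i * g z j) := by
    intro z
    rw [sq, Finset.sum_mul_sum]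
    exact Finset.sum_congr rfl fun i _ => Finset.sum_congr rfl fun j _ => by ring
  have hint : ∀ i j, Integrable (fun z => a i * a j * (g z i * g z j)) μ :=
    fun i j => (integrable_coord_mul hg hg i j).const_mul _
  simp only [h1]
  rw [integral_finsetSum _ fun i _ => integrable_finsetSum _ fun j _ => hint i j]
  simp only [integral_finsetSum _ fun j _ => hint _ j, integral_const_mul, dotProduct,
    Matrix.mulVec, Matrix.of_apply, Finset.mul_sum]
  exact Finset.sum_congr rfl fun i _ => Finset.sum_congr rfl fun j _ => by ring

end SecondMoment

section Score

variable {p : ℕ} {X : Type*} {q : Vec p → X → ℝ} {θ : Vec p} {x : X}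

lemma sum_mul_score (a : Fin p → ℝ) :
    ∑ i, a i * score q θ x i =
      fderiv ℝ (fun t => Real.log (q t x)) θ (WithLp.toLp 2 a) := by
  rw [← inner_gradient_left (𝕜 := ℝ), PiLp.inner_apply]
  rfl

lemma score_apply (i : Fin p) :
    score q θ x i = fderiv ℝ (fun t => Real.log (q t x)) θ (EuclideanSpace.single i 1) := by
  rw [← inner_gradient_left (𝕜 := ℝ), EuclideanSpace.inner_single_right]
  simp [score]

end Score

/-! ### Positive definiteness of the Fisher information of `m` observations -/

namespace BayesModel

variable {p d : ℕ} {M : BayesModel p d} {m : ℕ} {A : Set (Vec d)}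

/-- Regularity is assumed for the prior and the one-observation joint density, so each log
likelihood is written as their difference. -/
lemma IsCommonSupport.differentiableAt_log_jointSet (hA : M.IsCommonSupport A)
    (h : M.BCRBRegular) {θ : Vec p} (hθ : θ ∈ interior M.Θ) {x : Fin m → Vec d}
    (hx : ∀ j, x j ∈ M.Υ) (hxA : ∀ j, x j ∈ A) :
    DifferentiableAt ℝ (fun t => Real.log (M.jointSet m t x)) θ := by
  have hl : ∀ t ∈ interior M.Θ, ∀ j, 0 < M.lik t (x j) :=
    fun t ht j => (hA.2 t ht _ (hx j)).1 (hxA j)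
  have h1 : (fun t => Real.log (M.jointSet m t x)) =ᶠ[𝓝 θ] fun t => Real.log (M.prior t) +
      ∑ j, (Real.log (M.joint t (x j)) - Real.log (M.prior t)) := by
    filter_upwards [isOpen_interior.mem_nhds hθ] with t ht
    rw [jointSet, Real.log_mul (hA.1 t ht).ne' (Finset.prod_pos fun j _ => hl t ht j).ne',
      Real.log_prod fun j _ => (hl t ht j).ne']
    congr 1
    refine Finset.sum_congr rfl fun j _ => ?_
    rw [joint, Real.log_mul (hA.1 t ht).ne' (hl t ht j).ne', add_sub_cancel_left]
  have hp := h.diff_prior θ hθ (hA.1 θ hθ)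
  refine DifferentiableAt.congr_of_eventuallyEq (hp.add ?_) h1
  exact DifferentiableAt.fun_sum fun j _ =>
    (h.diff_joint _ (hx j) θ hθ (mul_pos (hA.1 θ hθ) (hl θ hθ j))).sub hp

/-- If the score of the observation set has no component along `a`, then the joint density is
locally constant along `a`. -/
lemma ae_jointSet_add_eq (h : M.BCRBRegular) (hA : M.IsCommonSupport A) {a : Fin p → ℝ}
    (h0 : ∀ᵐ z ∂(M.lawSet m), ∑ i, a i * score (M.jointSet m) z.1 z.2 i = 0) :
    ∀ᵐ x ∂(M.obsSetMeasure m), ∀ θ : Vec p, ∀ r t : ℝ, 0 < r →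
      Metric.ball θ (2 * r) ⊆ interior M.Θ → ‖t • WithLp.toLp 2 a‖ < r →
      M.jointSet m (θ + t • WithLp.toLp 2 a) x = M.jointSet m θ x := by
  rw [lawSet, ae_jointLaw_iff (M.measurable_jointSet m)] at h0
  -- The null set of observations is chosen before `θ`, `r` and `t`.
  filter_upwards [ae_ae_swap_of_ae_prod h0, M.ae_obsSetMeasure m] with x hx0 hx θ r t hr hball ht
  have hθ : θ ∈ interior M.Θ := hball (Metric.mem_ball_self (by positivity))
  have hθ' : θ + t • WithLp.toLp 2 a ∈ interior M.Θ := by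
    refine hball ?_
    rw [mem_ball_iff_norm, add_sub_cancel_left]
    linarith
  by_cases hxA : ∀ j, x j ∈ A
  · have h1 : ∀ᵐ t' ∂(volume.restrict (interior M.Θ)),
        fderiv ℝ (fun t => Real.log (M.jointSet m t x)) t' (t • WithLp.toLp 2 a) = 0 := by
      filter_upwards [ae_restrict_of_ae_restrict_of_subset interior_subset hx0,
        ae_restrict_mem isOpen_interior.measurableSet] with t' ht' hint
      have h2 := ht' (hA.jointSet_pos hint hx hxA)
      rw [sum_mul_score] at h2
      rw [map_smul, h2, smul_zero]
    have h3 := eq_of_ae_fderiv_eq_zero isOpen_interior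
      (fun t' ht' => hA.differentiableAt_log_jointSet h ht' hx hxA) h1 hr hball ht
    exact Real.log_injOn_pos (hA.jointSet_pos hθ' hx hxA) (hA.jointSet_pos hθ hx hxA) h3
  · rw [hA.jointSet_eq_zero hθ hx hxA, hA.jointSet_eq_zero hθ' hx hxA]

/-- The likelihood factors of all observations but the first integrate to one. -/
lemma setIntegral_joint (hm : 1 ≤ m) {θ : Vec p} (hθ : θ ∈ M.Θ) {B : Set (Vec d)}
    (hB : MeasurableSet B) :
    ∫ x in B, M.joint θ x ∂M.obsMeasure =
      ∫ x, (B.indicator (fun _ => (1 : ℝ)) (x ⟨0, hm⟩)) * M.jointSet m θ x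
        ∂(M.obsSetMeasure m) := by
  obtain ⟨n, rfl⟩ : ∃ n, m = n + 1 := ⟨m - 1, by omega⟩
  let f : Fin (n + 1) → Vec d → ℝ :=
    fun j x => if j = 0 then B.indicator (M.lik θ) x else M.lik θ x
  have h1 := integral_fintype_prod_eq_prod (𝕜 := ℝ) f (μ := fun _ => M.obsMeasure)
  have h2 : ∫ x, M.lik θ x ∂M.obsMeasure = 1 := M.integral_lik θ hθ
  have h3 : ∏ j, ∫ x, f j x ∂M.obsMeasure = ∫ x in B, M.lik θ x ∂M.obsMeasure := by
    rw [Fin.prod_univ_succ]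
    simp [f, h2, integral_indicator hB]
  simp only [joint]
  rw [integral_const_mul, ← h3, ← h1, ← integral_const_mul]
  refine integral_congr_ae (ae_of_all _ fun x => ?_)
  simp only [f, jointSet, Fin.prod_univ_succ, Fin.succ_ne_zero, if_true, if_false]
  by_cases hx : x 0 ∈ B
  · simp [hx]
  · simp [hx]

lemma ae_joint_eq_of_ae_jointSet_eq (hm : 1 ≤ m) {θ θ' : Vec p} (hθ : θ ∈ M.Θ) (hθ' : θ' ∈ M.Θ)
    (h : ∀ᵐ x ∂(M.obsSetMeasure m), M.jointSet m θ' x = M.jointSet m θ x) :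
    ∀ᵐ x ∂M.obsMeasure, M.joint θ' x = M.joint θ x := by
  refine Integrable.ae_eq_of_forall_setIntegral_eq _ _ ((integrable_lik hθ').const_mul _)
    ((integrable_lik hθ).const_mul _) fun B hB _ => ?_
  rw [setIntegral_joint hm hθ' hB, setIntegral_joint hm hθ hB]
  refine integral_congr_ae ?_
  filter_upwards [h] with x hx
  rw [hx]

/-- Marginalization transfers constancy along `a` to the joint density of one observation. Countably
many shifts tending to 0 share one null set and already determine the derivative, which exists by
assumption. -/
lemma ae_sum_mul_score_joint_eq_zero (hm : 1 ≤ m) (h : M.BCRBRegular) (hA : M.IsCommonSupport A)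
    {a : Fin p → ℝ} (h0 : ∀ᵐ z ∂(M.lawSet m), ∑ i, a i * score (M.jointSet m) z.1 z.2 i = 0)
    {θ : Vec p} (hθ : θ ∈ interior M.Θ) :
    ∀ᵐ x ∂M.obsMeasure, x ∈ A → ∑ i, a i * score M.joint θ x i = 0 := by
  set v : Vec p := WithLp.toLp 2 a with hv
  obtain ⟨r', hr', hball⟩ := Metric.isOpen_iff.1 isOpen_interior θ hθ
  set r := r' / 2 with hr
  have hr0 : 0 < r := by positivity
  have hball' : Metric.ball θ (2 * r) ⊆ interior M.Θ := by
    rwa [hr, mul_div_cancel₀ _ (two_ne_zero)]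
  -- These steps tend to 0 and keep `‖t n • v‖ < r`; the `+ 1` beside `‖v‖` allows `v = 0`.
  let t : ℕ → ℝ := fun n => r / (‖v‖ + 1) * (1 / ((n : ℝ) + 1))
  have htpos : ∀ n, 0 < t n := fun n => by positivity
  have htr : ∀ n, ‖t n • v‖ < r := by
    intro n
    have h1 : 1 / ((n : ℝ) + 1) ≤ 1 := by
      rw [div_le_one (by positivity)]
      linarith [(Nat.cast_nonneg n : (0 : ℝ) ≤ n)]
    rw [norm_smul, Real.norm_of_nonneg (htpos n).le]
    calc t n * ‖v‖ ≤ r / (‖v‖ + 1) * 1 * ‖v‖ := by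
          refine mul_le_mul_of_nonneg_right ?_ (norm_nonneg _)
          exact mul_le_mul_of_nonneg_left h1 (by positivity)
      _ < r := by
          rw [mul_one, div_mul_eq_mul_div, div_lt_iff₀ (by positivity)]
          nlinarith [norm_nonneg v]
  have htlim : Tendsto t atTop (𝓝[≠] 0) := by
    refine tendsto_nhdsWithin_iff.2 ⟨?_, Eventually.of_forall fun n => (htpos n).ne'⟩
    simpa [t] using (tendsto_one_div_add_atTop_nhds_zero_nat (𝕜 := ℝ)).const_mul (r / (‖v‖ + 1))
  have hmem : ∀ n, θ + t n • v ∈ M.Θ := fun n => interior_subset <| hball' <| by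
    rw [mem_ball_iff_norm, add_sub_cancel_left]
    linarith [htr n]
  have hshift : ∀ᵐ x ∂M.obsMeasure, ∀ n, M.joint (θ + t n • v) x = M.joint θ x := by
    rw [ae_all_iff]
    intro n
    refine ae_joint_eq_of_ae_jointSet_eq hm (interior_subset hθ) (hmem n) ?_
    filter_upwards [ae_jointSet_add_eq h hA h0] with x hx
    exact hx θ r (t n) hr0 hball' (htr n)
  filter_upwards [hshift, M.ae_obsMeasure] with x hx hxΥ hxA
  have hd := (h.diff_joint x hxΥ θ hθ
    (mul_pos (hA.1 θ hθ) ((hA.2 θ hθ x hxΥ).1 hxA))).hasFDerivAt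
  rw [sum_mul_score]
  have h2 := (hd.hasLineDerivAt v).tendsto_slope_zero.comp htlim
  refine tendsto_nhds_unique h2 ?_
  refine tendsto_const_nhds.congr fun n => ?_
  simp [hx n]

/-- The Bayesian Fisher information matrix of `m ≥ 1` observations is positive definite. -/
theorem posDef_F_B (hm : 1 ≤ m) (h : M.BCRBRegular) [IsFiniteMeasure (M.lawSet m)]
    (hL2 : MemLp (fun z => M.postScore m z.1 z.2) 2 (M.lawSet m)) : (M.F_B m).PosDef := by
  obtain ⟨A, hA⟩ := exists_isCommonSupport h
  have hF : M.F_B m = Matrix.of fun i j =>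
      ∫ z, M.postScore m z.1 z.2 i * M.postScore m z.1 z.2 j ∂(M.lawSet m) := by
    ext i j
    exact F_B_apply h i j
  refine Matrix.PosDef.of_dotProduct_mulVec_pos ?_ fun a ha => ?_
  · ext i j
    simp [hF, mul_comm]
  rw [star_trivial, hF, dotProduct_secondMoment_mulVec hL2]
  refine lt_of_le_of_ne (integral_nonneg fun z => sq_nonneg _) fun heq => ?_
  have h0 : ∀ᵐ z ∂(M.lawSet m), ∑ i, a i * score (M.jointSet m) z.1 z.2 i = 0 := by
    have h1 := (integral_eq_zero_iff_of_nonneg (fun z => sq_nonneg _)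
      (memLp_dotProduct hL2 a).integrable_sq).1 heq.symm
    filter_upwards [h1, ae_lawSet h hA] with z hz hz'
    rw [← hA.postScore_eq hz'.1 hz'.2.1 hz'.2.2.1 hz'.2.2.2]
    exact pow_eq_zero_iff two_ne_zero |>.1 hz
  have hpos := h.fim_posDef.dotProduct_mulVec_pos ha
  have hfim : a ⬝ᵥ (bfim M.Θ M.obsMeasure M.joint).mulVec a =
      ∫ z, (∑ i, a i * score M.joint z.1 z.2 i) ^ 2 ∂M.law :=
    dotProduct_secondMoment_mulVec h.fim_finite a
  rw [star_trivial, hfim, law, integral_jointLaw M.measurable_joint (ae_joint_nonneg h)] at hpos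
  have hint := (integrable_jointLaw_iff M.measurable_joint (ae_joint_nonneg h)).1
    (memLp_dotProduct h.fim_finite a).integrable_sq
  rw [integral_prod _ hint] at hpos
  refine hpos.ne' (integral_eq_zero_of_ae ?_)
  filter_upwards [ae_mem_interior h] with θ hθ
  refine integral_eq_zero_of_ae ?_
  by_cases hp0 : M.prior θ = 0
  · exact ae_of_all _ fun x => by simp [joint, hp0]
  · filter_upwards [ae_sum_mul_score_joint_eq_zero hm h hA h0 (hθ hp0), M.ae_obsMeasure]
      with x hx hxΥ
    by_cases hxA : x ∈ A
    · simp [hx hxA]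
    · simp [joint, (hA.2 θ (hθ hp0) x hxΥ).2 hxA]

end BayesModel

/-! ### Score matching: excess loss as mean squared error -/

section ScoreMatching

variable {p d k m : ℕ} {M : BayesModel p d} {S : Set (Vec k)}
  {s : Vec p → (Fin m → Vec d) → Vec k → Vec p} {w w₀ : Vec k} {A : Set (Vec d)}

/-- The derivative is an almost everywhere limit of difference quotients, which are jointly
measurable in `(θ, x)`. -/
lemma aemeasurable_jac (h : M.BCRBRegular) (hsm : ScoreMatchingRegular M S s)
    [IsFiniteMeasure (M.lawSet m)] (hw : w ∈ S) (v : Vec p) (i : Fin p) :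
    AEMeasurable (fun z => jac s z.1 z.2 w v i) (M.lawSet m) := by
  obtain ⟨A, hA⟩ := BayesModel.exists_isCommonSupport h
  let t : ℕ → ℝ := fun n => 1 / ((n : ℝ) + 1)
  have ht : Tendsto t atTop (𝓝[≠] 0) :=
    tendsto_nhdsWithin_iff.2 ⟨tendsto_one_div_add_atTop_nhds_zero_nat,
      Eventually.of_forall fun n => (by positivity : (0 : ℝ) < 1 / ((n : ℝ) + 1)).ne'⟩
  have hproj : Measurable fun u : Vec p => u i := by fun_prop
  refine aemeasurable_of_tendsto_metrizable_ae atTop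
    (f := fun n z => ((t n)⁻¹ • (s (z.1 + t n • v) z.2 w - s z.1 z.2 w)) i) (fun n => ?_) ?_
  · have h1 := hsm.measurable_model w hw
    have h2 : Measurable fun z : Vec p × (Fin m → Vec d) => s (z.1 + t n • v) z.2 w :=
      h1.comp (by fun_prop : Measurable fun z : Vec p × (Fin m → Vec d) => (z.1 + t n • v, z.2))
    exact (hproj.comp ((h2.sub h1).const_smul (t n)⁻¹)).aemeasurable
  · filter_upwards [BayesModel.ae_lawSet (m := m) h hA] with z hz
    have hd := (hsm.diff_model w hw z.2 hz.2.1 z.1 hz.1).hasFDerivAt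
    have h3 := (hd.hasLineDerivAt v).tendsto_slope_zero.comp ht
    exact ((EuclideanSpace.proj (𝕜 := ℝ) i).continuous.tendsto _).comp h3

lemma abs_jac_sub_le (i : Fin p) (θ : Vec p) (x : Fin m → Vec d) :
    |jac s θ x w (EuclideanSpace.single i 1) i - jac s θ x w₀ (EuclideanSpace.single i 1) i| ≤
      ‖jac s θ x w - jac s θ x w₀‖ := by
  have h1 := (jac s θ x w - jac s θ x w₀).le_opNorm (EuclideanSpace.single i 1)
  rw [PiLp.norm_single, norm_one, mul_one] at h1
  refine le_trans ?_ h1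
  have h2 := PiLp.norm_apply_le ((jac s θ x w - jac s θ x w₀) (EuclideanSpace.single i 1)) i
  simpa using h2

/-- The Jacobian of a single model is not assumed integrable, but `τ` dominates differences. This is
why the argument uses excess losses throughout. -/
lemma integrable_jac_sub (h : M.BCRBRegular) (hsm : ScoreMatchingRegular M S s)
    (hlip : LipschitzModel M S s) [IsFiniteMeasure (M.lawSet m)] (hw : w ∈ S) (hw₀ : w₀ ∈ S)
    (i : Fin p) :
    Integrable (fun z => jac s z.1 z.2 w (EuclideanSpace.single i 1) i -
      jac s z.1 z.2 w₀ (EuclideanSpace.single i 1) i) (M.lawSet m) := by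
  obtain ⟨ξ, τ, ζ, -, hτ, -, hl⟩ := hlip
  refine (hτ.mul_const ‖w - w₀‖).mono'
    ((aemeasurable_jac h hsm hw _ i).sub (aemeasurable_jac h hsm hw₀ _ i)).aestronglyMeasurable ?_
  filter_upwards [hl] with z hz
  exact (abs_jac_sub_le i _ _).trans (hz w hw w₀ hw₀).2.1

/-- The derivative of the posterior-weighted difference of two score models. -/
lemma hasFDerivAt_posterior_mul_sub (hsm : ScoreMatchingRegular M S s)
    (hA : M.IsCommonSupport A) (hw : w ∈ S) (hw₀ : w₀ ∈ S) {x : Fin m → Vec d}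
    (hx : ∀ j, x j ∈ M.Υ) (hxA : ∀ j, x j ∈ A) (he : 0 < M.evidence m x) (i : Fin p)
    {θ : Vec p} (hθ : θ ∈ interior M.Θ) :
    HasFDerivAt (fun t => posterior M.Θ (M.jointSet m) t x * (s t x w - s t x w₀) i)
      (posterior M.Θ (M.jointSet m) θ x •
          (EuclideanSpace.proj (𝕜 := ℝ) i).comp (jac s θ x w - jac s θ x w₀) +
        (s θ x w - s θ x w₀) i • posterior M.Θ (M.jointSet m) θ x •
          fderiv ℝ (fun t => Real.log (posterior M.Θ (M.jointSet m) t x)) θ) θ := by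
  have h1 : HasFDerivAt (fun t => posterior M.Θ (M.jointSet m) t x)
      (posterior M.Θ (M.jointSet m) θ x •
        fderiv ℝ (fun t => Real.log (posterior M.Θ (M.jointSet m) t x)) θ) θ := by
    have h2 := (hsm.diff_post x hx θ hθ (hA.jointSet_pos hθ hx hxA)).hasFDerivAt.exp
    rw [Real.exp_log (hA.posterior_pos hθ hx hxA he)] at h2
    refine h2.congr_of_eventuallyEq ?_
    filter_upwards [isOpen_interior.mem_nhds hθ] with t ht
    rw [Real.exp_log (hA.posterior_pos ht hx hxA he)]
  have h3 : HasFDerivAt (fun t => s t x w - s t x w₀) (jac s θ x w - jac s θ x w₀) θ :=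
    (hsm.diff_model w hw x hx θ hθ).hasFDerivAt.sub (hsm.diff_model w₀ hw₀ x hx θ hθ).hasFDerivAt
  exact h1.mul ((EuclideanSpace.proj (𝕜 := ℝ) i).hasFDerivAt.comp θ h3)

lemma integrable_stein (h : M.BCRBRegular) (hsm : ScoreMatchingRegular M S s)
    (hlip : LipschitzModel M S s) [IsFiniteMeasure (M.lawSet m)] (hw : w ∈ S) (hw₀ : w₀ ∈ S)
    (i : Fin p) :
    Integrable (fun z => (jac s z.1 z.2 w (EuclideanSpace.single i 1) i -
      jac s z.1 z.2 w₀ (EuclideanSpace.single i 1) i) +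
      (s z.1 z.2 w - s z.1 z.2 w₀) i * M.postScore m z.1 z.2 i) (M.lawSet m) :=
  (integrable_jac_sub h hsm hlip hw hw₀ i).add
    (integrable_coord_mul ((hsm.memLp_model w hw).sub (hsm.memLp_model w₀ hw₀)) hsm.memLp_post i i)

/-- Integration by parts in `θ` for the difference of two score models, conditionally on the
observations. -/
lemma setIntegral_stein (hsm : ScoreMatchingRegular M S s) (h : M.BCRBRegular)
    (hA : M.IsCommonSupport A) (hw : w ∈ S) (hw₀ : w₀ ∈ S) {x : Fin m → Vec d}
    (hx : ∀ j, x j ∈ M.Υ) (hint : Integrable (fun θ => M.jointSet m θ x) (volume.restrict M.Θ))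
    (i : Fin p)
    (hint' : Integrable (fun θ => M.jointSet m θ x *
      ((jac s θ x w (EuclideanSpace.single i 1) i - jac s θ x w₀ (EuclideanSpace.single i 1) i) +
        (s θ x w - s θ x w₀) i * M.postScore m θ x i)) (volume.restrict M.Θ)) :
    ∫ θ in M.Θ, M.jointSet m θ x *
      ((jac s θ x w (EuclideanSpace.single i 1) i - jac s θ x w₀ (EuclideanSpace.single i 1) i) +
        (s θ x w - s θ x w₀) i * M.postScore m θ x i) = 0 := by
  set K : Vec p → ℝ := fun θ =>
    (jac s θ x w (EuclideanSpace.single i 1) i - jac s θ x w₀ (EuclideanSpace.single i 1) i) +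
      (s θ x w - s θ x w₀) i * M.postScore m θ x i with hK
  have hrestr : ∫ θ in M.Θ, M.jointSet m θ x * K θ =
      ∫ θ in interior M.Θ, M.jointSet m θ x * K θ := by
    refine setIntegral_eq_of_subset_of_ae_sdiff_eq_zero
      M.isClosed_Θ.measurableSet.nullMeasurableSet interior_subset ?_
    have h1 := BayesModel.ae_mem_interior h
    rw [ae_restrict_iff' M.isClosed_Θ.measurableSet] at h1
    filter_upwards [h1] with θ hθ hd
    have h0 : M.prior θ = 0 := by
      by_contra hne
      exact hd.2 (hθ hd.1 hne)
    simp [BayesModel.jointSet, h0]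
  rw [hrestr]
  by_cases hxA : ∀ j, x j ∈ A
  swap
  · refine setIntegral_eq_zero_of_forall_eq_zero fun θ hθ => ?_
    rw [hA.jointSet_eq_zero hθ hx hxA, zero_mul]
  have he := hA.evidence_pos h hx hxA hint
  -- By the product rule, the `i`-th partial derivative of `G` is the posterior times `K`; the
  -- evidence is a constant factor in `θ`.
  set G : Vec p → ℝ := fun t => posterior M.Θ (M.jointSet m) t x * (s t x w - s t x w₀) i with hG
  have hder : ∀ θ ∈ interior M.Θ, M.jointSet m θ x * K θ =
      M.evidence m x * fderiv ℝ G θ (EuclideanSpace.single i 1) := by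
    intro θ hθ
    have hj : M.jointSet m θ x = M.evidence m x * posterior M.Θ (M.jointSet m) θ x :=
      (mul_div_cancel₀ _ he.ne').symm
    rw [(hasFDerivAt_posterior_mul_sub hsm hA hw hw₀ hx hxA he i hθ).fderiv, hj, mul_assoc]
    congr 1
    simp only [hK, BayesModel.postScore, score_apply]
    simp
    ring
  rw [setIntegral_congr_fun isOpen_interior.measurableSet hder, integral_const_mul]
  have hbd : VanishesAtBoundary M.Θ fun θ =>
      posterior M.Θ (M.jointSet m) θ x • (s θ x w - s θ x w₀) := by
    have hb1 := hsm.boundary w hw x hx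
    have hb2 := hsm.boundary w₀ hw₀ x hx
    refine ⟨fun θ₀ hθ₀ => ?_, ?_⟩
    · simpa [smul_sub] using (hb1.1 θ₀ hθ₀).sub (hb2.1 θ₀ hθ₀)
    · simpa [smul_sub] using hb1.2.sub hb2.2
  have hcoord : ∀ l : Filter (Vec p), Tendsto (fun θ =>
      posterior M.Θ (M.jointSet m) θ x • (s θ x w - s θ x w₀)) l (𝓝 0) → Tendsto G l (𝓝 0) :=
    fun l hl => ((EuclideanSpace.proj (𝕜 := ℝ) i).continuous.tendsto' 0 0 (by simp)).comp hl
  rw [integral_fderiv_eq_zero_of_vanishes M.isClosed_Θ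
    (fun θ hθ => (hasFDerivAt_posterior_mul_sub hsm hA hw hw₀ hx hxA he i hθ).differentiableAt)
    (fun θ₀ hθ₀ => hcoord _ (hbd.1 θ₀ hθ₀)) (hcoord _ hbd.2), mul_zero]
  have h2 : IntegrableOn (fun θ => (M.evidence m x)⁻¹ * (M.jointSet m θ x * K θ))
      (interior M.Θ) := (IntegrableOn.mono_set hint' interior_subset).const_mul _
  refine h2.congr_fun (fun θ hθ => ?_) isOpen_interior.measurableSet
  simp only [hder θ hθ]
  rw [inv_mul_cancel_left₀ he.ne']

/-- Stein's identity for the difference of two score models. -/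
theorem integral_stein (h : M.BCRBRegular) (hsm : ScoreMatchingRegular M S s)
    (hlip : LipschitzModel M S s) [IsFiniteMeasure (M.lawSet m)] (hw : w ∈ S) (hw₀ : w₀ ∈ S)
    (i : Fin p) :
    ∫ z, ((jac s z.1 z.2 w (EuclideanSpace.single i 1) i -
      jac s z.1 z.2 w₀ (EuclideanSpace.single i 1) i) +
      (s z.1 z.2 w - s z.1 z.2 w₀) i * M.postScore m z.1 z.2 i) ∂(M.lawSet m) = 0 := by
  obtain ⟨A, hA⟩ := BayesModel.exists_isCommonSupport h
  have hint := (integrable_jointLaw_iff (M.measurable_jointSet m)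
    (BayesModel.ae_jointSet_nonneg h m)).1 (integrable_stein h hsm hlip hw hw₀ i)
  rw [BayesModel.lawSet, integral_jointLaw (M.measurable_jointSet m)
    (BayesModel.ae_jointSet_nonneg h m), integral_prod_symm _ hint]
  refine integral_eq_zero_of_ae ?_
  filter_upwards [M.ae_obsSetMeasure m, BayesModel.ae_integrable_jointSet h, hint.prod_left_ae]
    with x hx hi hi'
  exact setIntegral_stein hsm h hA hw hw₀ hx hi i hi'

/-- The excess loss of `w` over `w₀`, when `w₀` realizes the posterior score, as a squared error
plus a term of mean zero. -/
lemma ae_sampleLoss_sub_eq (hw₀ : ∀ᵐ z ∂(M.lawSet m), s z.1 z.2 w₀ = M.postScore m z.1 z.2) :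
    ∀ᵐ z ∂(M.lawSet m), sampleLoss s z w - sampleLoss s z w₀ =
      ‖s z.1 z.2 w - s z.1 z.2 w₀‖ ^ 2 +
        2 * ∑ i, ((jac s z.1 z.2 w (EuclideanSpace.single i 1) i -
          jac s z.1 z.2 w₀ (EuclideanSpace.single i 1) i) +
          (s z.1 z.2 w - s z.1 z.2 w₀) i * M.postScore m z.1 z.2 i) := by
  filter_upwards [hw₀] with z hz
  -- With `s_{w₀}` as the posterior score, the claim is `‖u‖² - ‖v‖² = ‖u - v‖² + 2⟨u - v, v⟩` plus
  -- the Jacobian terms.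
  rw [← hz]
  simp only [sampleLoss, EuclideanSpace.real_norm_sq_eq, Finset.mul_sum, ← Finset.sum_add_distrib,
    ← Finset.sum_sub_distrib, PiLp.sub_apply]
  exact Finset.sum_congr rfl fun i _ => by ring

lemma integrable_sq_sub (hsm : ScoreMatchingRegular M S s) (hw : w ∈ S) (hw₀ : w₀ ∈ S) :
    Integrable (fun z => ‖s z.1 z.2 w - s z.1 z.2 w₀‖ ^ 2) (M.lawSet m) :=
  ((hsm.memLp_model w hw).sub (hsm.memLp_model w₀ hw₀)).norm.integrable_sq

/-- The expected excess loss is the mean squared error of the score. -/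
theorem integrable_and_integral_sampleLoss_sub (h : M.BCRBRegular)
    (hsm : ScoreMatchingRegular M S s) (hlip : LipschitzModel M S s)
    [IsFiniteMeasure (M.lawSet m)] (hw : w ∈ S) (hw₀S : w₀ ∈ S)
    (hw₀ : ∀ᵐ z ∂(M.lawSet m), s z.1 z.2 w₀ = M.postScore m z.1 z.2) :
    Integrable (fun z => sampleLoss s z w - sampleLoss s z w₀) (M.lawSet m) ∧
      ∫ z, (sampleLoss s z w - sampleLoss s z w₀) ∂(M.lawSet m) =
        ∫ z, ‖s z.1 z.2 w - s z.1 z.2 w₀‖ ^ 2 ∂(M.lawSet m) := by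
  have hst := fun i => integrable_stein h hsm hlip hw hw₀S i
  have hsum := (integrable_finsetSum Finset.univ fun i _ => hst i).const_mul 2
  have hsq := integrable_sq_sub hsm hw hw₀S
  refine ⟨(hsq.add hsum).congr ((ae_sampleLoss_sub_eq hw₀).mono fun z hz => hz.symm), ?_⟩
  rw [integral_congr_ae (ae_sampleLoss_sub_eq hw₀), integral_add hsq hsum, integral_const_mul,
    integral_finsetSum _ fun i _ => hst i,
    Finset.sum_eq_zero fun i _ => integral_stein h hsm hlip hw hw₀S i, mul_zero, add_zero]

end ScoreMatching

/-! ### Consistency of the empirical minimizer and of the learned matrix -/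

section Consistency

variable {p d k m : ℕ} {M : BayesModel p d} {S : Set (Vec k)}
  {s : Vec p → (Fin m → Vec d) → Vec k → Vec p} {w w₀ : Vec k}

/-- The left side is a trace with `p` diagonal entries. Through it, `ζ` controls the quadratic part
of the loss. -/
lemma abs_norm_sq_sub_norm_sq_le (u v : Vec p) :
    |‖u‖ ^ 2 - ‖v‖ ^ 2| ≤ p * frobNorm (outer u - outer v) := by
  have h1 : ‖u‖ ^ 2 - ‖v‖ ^ 2 = ∑ i, (outer u - outer v) i i := by
    simp only [EuclideanSpace.real_norm_sq_eq, ← Finset.sum_sub_distrib]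
    exact Finset.sum_congr rfl fun i _ => by simp [outer, sq]
  rw [h1]
  refine (Finset.abs_sum_le_sum_abs _ _).trans ?_
  refine (Finset.sum_le_sum fun i _ => abs_entry_le_frobNorm _ i i).trans_eq ?_
  simp

lemma abs_sampleLoss_sub_le (z : Vec p × (Fin m → Vec d)) (w₁ w₂ : Vec k) :
    |sampleLoss s z w₁ - sampleLoss s z w₂| ≤
      p * frobNorm (outer (s z.1 z.2 w₁) - outer (s z.1 z.2 w₂)) +
        2 * (p * ‖jac s z.1 z.2 w₁ - jac s z.1 z.2 w₂‖) := by
  have h1 : |∑ i, (jac s z.1 z.2 w₁ (EuclideanSpace.single i 1) i -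
      jac s z.1 z.2 w₂ (EuclideanSpace.single i 1) i)| ≤
      p * ‖jac s z.1 z.2 w₁ - jac s z.1 z.2 w₂‖ := by
    refine (Finset.abs_sum_le_sum_abs _ _).trans ?_
    refine (Finset.sum_le_sum fun i _ => abs_jac_sub_le i _ _).trans_eq ?_
    simp
  have h2 := abs_norm_sq_sub_norm_sq_le (s z.1 z.2 w₁) (s z.1 z.2 w₂)
  rw [Finset.sum_sub_distrib] at h1
  rw [sampleLoss, sampleLoss]
  rw [abs_le] at h1 h2 ⊢
  constructor <;> linarith [h1.1, h1.2, h2.1, h2.2]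

/-- Expansion around `v` and the weighted inequality `2ab ≤ a²/δ + δb²`. The weight `δ` makes the
term that does not tend to zero small. -/
lemma abs_mul_sub_mul_le {δ : ℝ} (hδ : 0 < δ) (u v : Vec p) (i j : Fin p) :
    |u i * u j - v i * v j| ≤ (1 + 1 / δ) * ‖u - v‖ ^ 2 + δ * ‖v‖ ^ 2 := by
  have hu : ∀ i, |u i - v i| ≤ ‖u - v‖ := fun i => PiLp.norm_apply_le (u - v) i
  have hv : ∀ i, |v i| ≤ ‖v‖ := fun i => PiLp.norm_apply_le v i
  have h1 : u i * u j - v i * v j =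
      (u i - v i) * (u j - v j) + v i * (u j - v j) + (u i - v i) * v j := by ring
  have h2 : |u i * u j - v i * v j| ≤
      ‖u - v‖ * ‖u - v‖ + ‖v‖ * ‖u - v‖ + ‖u - v‖ * ‖v‖ := by
    rw [h1]
    refine (abs_add_three _ _ _).trans ?_
    simp only [abs_mul]
    gcongr <;> first | exact hu _ | exact hv _
  have h3 : 2 * (‖v‖ * ‖u - v‖) ≤ 1 / δ * ‖u - v‖ ^ 2 + δ * ‖v‖ ^ 2 := by
    have h4 : 0 ≤ 1 / δ * (‖u - v‖ - δ * ‖v‖) ^ 2 := by positivity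
    have h5 : 1 / δ * (‖u - v‖ - δ * ‖v‖) ^ 2 =
        1 / δ * ‖u - v‖ ^ 2 + δ * ‖v‖ ^ 2 - 2 * (‖v‖ * ‖u - v‖) := by
      field_simp
      ring
    linarith
  nlinarith

/-- If the mean squared error of the score tends to zero along a sequence of parameters, then the
second moments of the score model converge to those of the limit. -/
lemma tendsto_integral_mul_of_tendsto_sq (hsm : ScoreMatchingRegular M S s) (hw₀ : w₀ ∈ S)
    {u : ℕ → Vec k} (hu : ∀ᶠ N in atTop, u N ∈ S)
    (h : Tendsto (fun N => ∫ z, ‖s z.1 z.2 (u N) - s z.1 z.2 w₀‖ ^ 2 ∂(M.lawSet m)) atTop (𝓝 0))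
    (i j : Fin p) :
    Tendsto (fun N => ∫ z, s z.1 z.2 (u N) i * s z.1 z.2 (u N) j ∂(M.lawSet m)) atTop
      (𝓝 (∫ z, s z.1 z.2 w₀ i * s z.1 z.2 w₀ j ∂(M.lawSet m))) := by
  rw [Metric.tendsto_nhds]
  intro ε hε
  set C := ∫ z, ‖s z.1 z.2 w₀‖ ^ 2 ∂(M.lawSet m) with hC
  have hC0 : 0 ≤ C := integral_nonneg fun z => by positivity
  -- The fixed term is then below `3ε/4`, which leaves `ε/4` for the vanishing one; `C + 1` avoids
  -- division by zero.
  set δ := ε / (2 * (C + 1)) with hδdef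
  have hδ : 0 < δ := by positivity
  have hδC : δ * C < ε / 2 + ε / 4 := by
    have : δ * (C + 1) = ε / 2 := by rw [hδdef]; field_simp
    nlinarith
  have h1 := h.const_mul (1 + 1 / δ)
  rw [mul_zero] at h1
  filter_upwards [h1.eventually_lt_const (by positivity : (0 : ℝ) < ε / 4), hu] with N hN hNu
  have hsq := integrable_sq_sub hsm hNu hw₀
  have hw₀sq := (hsm.memLp_model w₀ hw₀).norm.integrable_sq
  rw [Real.dist_eq, ← integral_sub
    (integrable_coord_mul (hsm.memLp_model _ hNu) (hsm.memLp_model _ hNu) i j)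
    (integrable_coord_mul (hsm.memLp_model _ hw₀) (hsm.memLp_model _ hw₀) i j), ← Real.norm_eq_abs]
  refine (norm_integral_le_of_norm_le ((hsq.const_mul (1 + 1 / δ)).add (hw₀sq.const_mul δ))
    (ae_of_all (M.lawSet m) fun z =>
      abs_mul_sub_mul_le hδ (s z.1 z.2 (u N)) (s z.1 z.2 w₀) i j)).trans_lt ?_
  simp only [Pi.add_apply]
  rw [integral_add (hsq.const_mul _) (hw₀sq.const_mul _), integral_const_mul, integral_const_mul]
  linarith

lemma learnedBFIM_apply (z : ℕ → Vec p × (Fin m → Vec d)) (N : ℕ) (w : Vec k) (i j : Fin p) :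
    learnedBFIM s z N w i j = empMean z N fun z => s z.1 z.2 w i * s z.1 z.2 w j := by
  simp [learnedBFIM, empMean, Matrix.sum_apply, outer]

lemma posSemidef_learnedBFIM (z : ℕ → Vec p × (Fin m → Vec d)) (N : ℕ) (w : Vec k) :
    (learnedBFIM s z N w).PosSemidef :=
  (Matrix.posSemidef_sum _ fun n _ => posSemidef_outer _).smul (by positivity)

variable {Ω : Type*} [MeasurableSpace Ω] {P : Measure Ω}
  {Z : ℕ → Ω → Vec p × (Fin m → Vec d)} {wstar : ℕ → Ω → Vec k}

/-- The mean squared error of the empirical risk minimiser tends to zero almost surely. -/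
theorem ae_tendsto_integral_sq_sub (hS : IsCompact S) (h : M.BCRBRegular)
    (hsm : ScoreMatchingRegular M S s) (hlip : LipschitzModel M S s)
    [IsFiniteMeasure (M.lawSet m)] (hw₀S : w₀ ∈ S)
    (hw₀ : ∀ᵐ z ∂(M.lawSet m), s z.1 z.2 w₀ = M.postScore m z.1 z.2)
    (hZ : ∀ n, Measurable (Z n)) (hind : iIndepFun Z P) (hlaw : ∀ n, P.map (Z n) = M.lawSet m)
    (hmin : ∀ᵐ ω ∂P, ∀ N, 1 ≤ N →
      wstar N ω ∈ S ∧ IsMinOn (empLoss s (fun n => Z n ω) N) S (wstar N ω)) :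
    ∀ᵐ ω ∂P, Tendsto
      (fun N => ∫ z, ‖s z.1 z.2 (wstar N ω) - s z.1 z.2 w₀‖ ^ 2 ∂(M.lawSet m)) atTop (𝓝 0) := by
  obtain ⟨ξ, τ, ζ, -, hτ, hζ, hl⟩ := id hlip
  have hrisk := fun w (hw : w ∈ S) =>
    integrable_and_integral_sampleLoss_sub h hsm hlip hw hw₀S hw₀
  have hulln := ae_tendsto_empMean_sub_integral hS hZ hind hlaw
    (f := fun z w => sampleLoss s z w - sampleLoss s z w₀) (fun w hw => (hrisk w hw).1)
    (L := fun z => p * ζ z + 2 * (p * τ z))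
    ((hζ.const_mul _).add ((hτ.const_mul _).const_mul 2)) (by
      filter_upwards [hl] with z hz w₁ h₁ w₂ h₂
      obtain ⟨-, e1, e2⟩ := hz w₁ h₁ w₂ h₂
      rw [sub_sub_sub_cancel_right]
      refine (abs_sampleLoss_sub_le z w₁ w₂).trans ?_
      have hp : (0 : ℝ) ≤ p := Nat.cast_nonneg p
      linarith [mul_le_mul_of_nonneg_left e1 hp, mul_le_mul_of_nonneg_left e2 hp])
  filter_upwards [hulln, hmin] with ω hω hωmin
  have hu : ∀ᶠ N in atTop, wstar N ω ∈ S :=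
    (eventually_ge_atTop 1).mono fun N hN => (hωmin N hN).1
  have h1 := (hω (fun N => wstar N ω) hu).neg
  rw [neg_zero] at h1
  refine tendsto_of_tendsto_of_tendsto_of_le_of_le' tendsto_const_nhds h1
    (Eventually.of_forall fun N => integral_nonneg fun z => by positivity) ?_
  filter_upwards [eventually_ge_atTop 1] with N hN
  obtain ⟨hNS, hNmin⟩ := hωmin N hN
  -- Comparing the minimizer with `w₀` makes the empirical excess nonpositive, so the mean squared
  -- error is at most the deviation in the uniform law.
  have h2 : empMean (fun n => Z n ω) N
      (fun z => sampleLoss s z (wstar N ω) - sampleLoss s z w₀) ≤ 0 := by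
    rw [empMean_sub]
    exact sub_nonpos.2 (hNmin hw₀S)
  rw [(hrisk _ hNS).2]
  linarith

/-- The uniform law replaces empirical second moments by expectations at the minimizer, and the
vanishing mean squared error moves these to `w₀`. -/
theorem ae_tendsto_learnedBFIM (hS : IsCompact S) (h : M.BCRBRegular)
    (hsm : ScoreMatchingRegular M S s) (hlip : LipschitzModel M S s) (hreal : Realizable M S s)
    [IsFiniteMeasure (M.lawSet m)]
    (hZ : ∀ n, Measurable (Z n)) (hind : iIndepFun Z P) (hlaw : ∀ n, P.map (Z n) = M.lawSet m)
    (hmin : ∀ᵐ ω ∂P, ∀ N, 1 ≤ N →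
      wstar N ω ∈ S ∧ IsMinOn (empLoss s (fun n => Z n ω) N) S (wstar N ω)) :
    ∀ᵐ ω ∂P, Tendsto (fun N => learnedBFIM s (fun n => Z n ω) N (wstar N ω)) atTop
      (𝓝 (M.F_B m)) := by
  obtain ⟨w₀, hw₀S, hw₀⟩ := hreal
  obtain ⟨ξ, τ, ζ, -, -, hζ, hl⟩ := id hlip
  have hulln : ∀ᵐ ω ∂P, ∀ i j, ∀ u : ℕ → Vec k, (∀ᶠ N in atTop, u N ∈ S) →
      Tendsto (fun N => empMean (fun n => Z n ω) N (fun z => s z.1 z.2 (u N) i * s z.1 z.2 (u N) j)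
        - ∫ z, s z.1 z.2 (u N) i * s z.1 z.2 (u N) j ∂(M.lawSet m)) atTop (𝓝 0) := by
    refine ae_all_iff.2 fun i => ae_all_iff.2 fun j => ?_
    refine ae_tendsto_empMean_sub_integral hS hZ hind hlaw
      (f := fun z w => s z.1 z.2 w i * s z.1 z.2 w j)
      (fun w hw => integrable_coord_mul (hsm.memLp_model w hw) (hsm.memLp_model w hw) i j) hζ ?_
    filter_upwards [hl] with z hz w₁ h₁ w₂ h₂
    refine le_trans ?_ (hz w₁ h₁ w₂ h₂).2.2
    exact abs_entry_le_frobNorm (outer (s z.1 z.2 w₁) - outer (s z.1 z.2 w₂)) i j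
  filter_upwards [hulln, hmin,
    ae_tendsto_integral_sq_sub hS h hsm hlip hw₀S hw₀ hZ hind hlaw hmin] with ω hω hωmin hωsq
  have hu : ∀ᶠ N in atTop, wstar N ω ∈ S :=
    (eventually_ge_atTop 1).mono fun N hN => (hωmin N hN).1
  refine tendsto_pi_nhds.2 fun i => tendsto_pi_nhds.2 fun j => ?_
  have h1 := (hω i j (fun N => wstar N ω) hu).add
    (tendsto_integral_mul_of_tendsto_sq hsm hw₀S hu hωsq i j)
  have hF : M.F_B m i j = ∫ z, s z.1 z.2 w₀ i * s z.1 z.2 w₀ j ∂(M.lawSet m) := by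
    rw [BayesModel.F_B_apply h]
    refine integral_congr_ae ?_
    filter_upwards [hw₀] with z hz
    rw [hz]
  rw [hF]
  simpa only [learnedBFIM_apply, sub_add_cancel, zero_add] using h1

end Consistency

end LBCRB

theorem mainTheorem12 {p d k m : ℕ} (hm : 1 ≤ m) (M : BayesModel p d)
    (S : Set (Vec k)) (hS : IsCompact S)
    (s : Vec p → (Fin m → Vec d) → Vec k → Vec p)
    (hreg : M.BCRBRegular)
    (hsm : ScoreMatchingRegular M S s)
    (hlip : LipschitzModel M S s)
    (hreal : Realizable M S s)
    {Ω : Type*} [MeasurableSpace Ω] (P : Measure Ω) [IsProbabilityMeasure P]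
    (Z : ℕ → Ω → Vec p × (Fin m → Vec d))
    (hZ_meas : ∀ n, Measurable (Z n))
    (hZ_indep : iIndepFun Z P)
    (hZ_law : ∀ n, P.map (Z n) = M.lawSet m)
    (wstar : ℕ → Ω → Vec k)
    (hmin : ∀ᵐ ω ∂P, ∀ N, 1 ≤ N →
      wstar N ω ∈ S ∧ IsMinOn (empLoss s (fun n => Z n ω) N) S (wstar N ω))
    (cB : ℕ → Ω → ℝ)
    (hcB : ∀ᵐ ω ∂P, ∀ N, 1 ≤ N → ∀ n < N,
      ‖s (Z n ω).1 (Z n ω).2 (wstar N ω)‖ ^ 2 ≤ cB N ω)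
    (hcB_lim : ∀ᵐ ω ∂P, Tendsto (fun N : ℕ => cB N ω / N) atTop (𝓝 0)) :
    (M.F_B m).PosDef ∧
    ∀ᵐ ω ∂P,
      (∀ᶠ N in atTop, (learnedBFIM s (fun n => Z n ω) N (wstar N ω)).PosDef) ∧
      Tendsto (fun N => learnedBCRB s (fun n => Z n ω) N (wstar N ω)) atTop (𝓝 (M.bcrb m)) := by
  -- Total mass one is inherited from `P` through the law of `Z 0`.
  have hprob : IsProbabilityMeasure (M.lawSet m) :=
    hZ_law 0 ▸ Measure.isProbabilityMeasure_map (hZ_meas 0).aemeasurable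
  have hpd := BayesModel.posDef_F_B hm hreg hsm.memLp_post
  refine ⟨hpd, ?_⟩
  filter_upwards [ae_tendsto_learnedBFIM hS hreg hsm hlip hreal hZ_meas hZ_indep hZ_law hmin]
    with ω hω
  exact eventually_posDef_and_tendsto_inv (fun N => posSemidef_learnedBFIM _ N _) hpd hω
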